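/- Let $\mathbb{D}=\{z\in\mathbb{C}: |z|\le 1\}$ be the closed Euclidean unit disk, and describe the inward-pointing unit vectors at its boundary by fan-beam coordinates $(\beta,\alpha)\in\mathbb{S}^1\times(-\pi/2,\pi/2)$: the base point is $e^{i\beta}$ and the direction is $e^{i(\beta+\pi+\alpha)}$. Let $$I_0\colon L^2(\mathbb{D},dx\,dy;\mathbb{C})\to L^2(\mathbb{S}^1\times(-\pi/2,\pi/2),d\beta\,d\alpha;\mathbb{C}),\qquad I_0f(\beta,\alpha)=\int_0^{2\cos\alpha}f\big(e^{i\beta}+t\,e^{i(\beta+\pi+\alpha)}\big)\,dt$$ be the X-ray transform, which is a bounded operator, and let $I_0^*$ be its adjoint between these Hilbert spaces. Let $\mathcal{L}$ be the differential operator given in polar coordinates $(\rho,\omega)$ by $$\mathcal{L}=-\Big((1-\rho^2)\partial_\rho^2+\Big(\frac1\rho-3\rho\Big)\partial_\rho+\frac1{\rho^2}\partial_\omega^2\Big)+1$$ on $C^\infty(\mathbb{D})$ (functions smooth up to the boundary), and denote by the same letter its closure, an unbounded operator on $L^2(\mathbb{D})$ with domain $D(\mathcal{L})$. Then for every $f\in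 L^2(\mathbb{D})$ we have $(I_0^*I_0)^2f\in D(\mathcal{L})$ and $$\mathcal{L}\,(I_0^*I_0)^2f=(4\pi)^2f .$$ Moreover, put $$\psi_{n,k}(\beta,\alpha)=\frac{(-1)^n}{4\pi}e^{i(n-2k)(\beta+\alpha)}\big(e^{i(n+1)\alpha}+(-1)^ne^{-i(n+1)\alpha}\big)$$ and let $Z_{n,k}=I_0^*\psi_{n,k}$ (the Zernike polynomials). Then for all integers $n\ge 0$ and $0\le k\le n$, the function $Z_{n,k}$ belongs to $C^\infty(\mathbb{D})$, and $$I_0^*I_0Z_{n,k}=\frac{4\pi}{n+1}Z_{n,k},\qquad \mathcal{L}Z_{n,k}=(n+1)^2Z_{n,k}.$$ -/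

import Mathlib

open MeasureTheory Set Complex
open scoped ENNReal ContDiff Real

noncomputable section

namespace DiskXray

/-! ### The closed unit disk and the manifold of inward-pointing boundary vectors -/

/-- The closed Euclidean unit disk, as a subset of the plane. -/
def disk : Set ℂ := Metric.closedBall 0 1

/-- Lebesgue measure on the closed unit disk. -/
def diskMeasure : Measure ℂ := volume.restrict disk

/-- The domain of the fan-beam coordinates `(β, α)`: `β` runs once around the circle (`e^{iβ}` is
the boundary point) and `α ∈ (-π/2, π/2)` is the angle to the inward normal. -/
def fan : Set (ℝ × ℝ) := Ioc (-π) π ×ˢ Ioo (-(π / 2)) (π / 2)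

/-- The measure `dβ dα` on the manifold of inward-pointing boundary vectors. -/
def fanMeasure : Measure (ℝ × ℝ) := volume.restrict fan

/-- The point reached at time `t` by the unit-speed line issued from the boundary point `e^{iβ}`
in the direction `e^{i(β+π+α)}`. -/
def ray (p : ℝ × ℝ) (t : ℝ) : ℂ :=
  exp (I * p.1) + t * exp (I * (p.1 + π + p.2))

/-- The time at which the line `ray (β, α)` leaves the disk. -/
def exitTime (p : ℝ × ℝ) : ℝ := 2 * Real.cos p.2

/-- The X-ray transform of a function: its integral along the chord described by `(β, α)`. -/
def xray (f : ℂ → ℂ) (p : ℝ × ℝ) : ℂ := ∫ t in (0 : ℝ)..exitTime p, f (ray p t)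

/-- The complex Hilbert space `L²` of the disk. -/
abbrev L2Disk : Type := Lp ℂ 2 diskMeasure

/-- The complex Hilbert space `L²` of the inward-pointing boundary vectors, for `dβ dα`. -/
abbrev L2Fan : Type := Lp ℂ 2 fanMeasure

theorem measurableSet_disk : MeasurableSet disk := Metric.isClosed_closedBall.measurableSet

theorem measurableSet_fan : MeasurableSet fan := measurableSet_Ioc.prod measurableSet_Ioo

instance : IsFiniteMeasure diskMeasure :=
  ⟨by
    rw [diskMeasure, Measure.restrict_apply_univ]
    exact (isCompact_closedBall (0 : ℂ) 1).measure_lt_top⟩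

instance : IsFiniteMeasure fanMeasure :=
  ⟨by
    rw [fanMeasure, Measure.restrict_apply_univ, fan, Measure.volume_eq_prod, Measure.prod_prod]
    exact ENNReal.mul_lt_top measure_Ioc_lt_top measure_Ioo_lt_top⟩

theorem cos_pos_of_mem_fan {p : ℝ × ℝ} (hp : p ∈ fan) : 0 < Real.cos p.2 :=
  Real.cos_pos_of_mem_Ioo hp.2

theorem ray_eq (p : ℝ × ℝ) (t : ℝ) :
    ray p t = exp (I * (p.1 + p.2 : ℝ)) * (((Real.cos p.2 - t : ℝ) : ℂ) - Real.sin p.2 * I) := by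
  have h1 : (((Real.cos p.2 - t : ℝ) : ℂ) - Real.sin p.2 * I) = exp (-(p.2 * I)) - t := by
    rw [← neg_mul, exp_mul_I, Complex.cos_neg, Complex.sin_neg]
    push_cast
    ring
  have h2 : exp (I * ((p.1 : ℂ) + π + p.2)) = - exp (I * (p.1 + p.2)) := by
    rw [show I * ((p.1 : ℂ) + π + p.2) = I * (p.1 + p.2) + π * I by ring, exp_add, exp_pi_mul_I]
    ring
  rw [h1, ray, h2, mul_sub, ← exp_add]
  push_cast
  rw [show I * ((p.1 : ℂ) + p.2) + -(p.2 * I) = I * p.1 by ring]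
  ring

/-- For nonnegative times, the line is in the disk exactly up to the exit time. -/
theorem ray_mem_disk_iff {p : ℝ × ℝ} {t : ℝ} (ht : 0 < t) :
    ray p t ∈ disk ↔ t ≤ exitTime p := by
  have h : ‖ray p t‖ ^ 2 = 1 + t * (t - 2 * Real.cos p.2) := by
    rw [ray_eq, norm_mul, mul_comm I, norm_exp_ofReal_mul_I, one_mul, Complex.sq_norm,
      Complex.normSq_apply]
    simp only [sub_re, sub_im, ofReal_re, ofReal_im, mul_re, mul_im, I_re, I_im]
    nlinarith [Real.sin_sq_add_cos_sq p.2]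
  rw [disk, mem_closedBall_zero_iff, exitTime, ← sq_le_one_iff₀ (norm_nonneg _), h]
  constructor
  · intro h1
    nlinarith
  · intro h1
    nlinarith

theorem continuous_ray : Continuous (fun q : (ℝ × ℝ) × ℝ => ray q.1 q.2) := by
  unfold ray
  fun_prop

/-! ### The X-ray transform as a bounded operator on `L²` -/

theorem measurable_ray : Measurable (fun q : (ℝ × ℝ) × ℝ => ray q.1 q.2) :=
  continuous_ray.measurable

theorem measurable_exitTime : Measurable exitTime := by
  unfold exitTime
  fun_prop

/-- The integral of a function along a line at signed distance `-s` from the origin. -/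
def lineIntegral (g : ℂ → ℝ≥0∞) (θ s : ℝ) : ℝ≥0∞ :=
  ∫⁻ u : ℝ, g (exp (I * θ) * ((u : ℂ) - s * I))

theorem measurable_lineIntegral {g : ℂ → ℝ≥0∞} (hg : Measurable g) :
    Measurable (fun q : ℝ × ℝ => lineIntegral g q.1 q.2) := by
  unfold lineIntegral
  refine Measurable.lintegral_prod_right' (f := fun r : (ℝ × ℝ) × ℝ =>
    g (exp (I * r.1.1) * ((r.2 : ℂ) - r.1.2 * I))) ?_
  refine hg.comp (Continuous.measurable ?_)
  fun_prop

theorem lintegral_lineIntegral {g : ℂ → ℝ≥0∞} (hg : Measurable g) (θ : ℝ) :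
    ∫⁻ s : ℝ, lineIntegral g θ s = ∫⁻ z, g z := by
  have hrot : ∀ z : ℂ, rotation (Circle.exp θ) z = exp (I * θ) * z := by
    intro z
    rw [rotation_apply, Circle.coe_exp, mul_comm I]
  have h1 : ∫⁻ z, g z = ∫⁻ z, g (exp (I * θ) * z) := by
    have := (rotation (Circle.exp θ)).measurePreserving.lintegral_comp hg
    rw [← this]
    simp only [hrot]
  have hg2 : Measurable (fun z : ℂ => g (exp (I * θ) * z)) :=
    hg.comp (Continuous.measurable (by fun_prop))
  rw [h1, ← volume_preserving_equiv_real_prod.symm.lintegral_comp hg2, Measure.volume_eq_prod,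
    lintegral_prod_symm' (fun r : ℝ × ℝ => g (exp (I * θ) * measurableEquivRealProd.symm r))
      (hg2.comp measurableEquivRealProd.symm.measurable)]
  rw [← lintegral_neg_eq_self]
  refine lintegral_congr fun s => lintegral_congr fun u => ?_
  congr 2
  simp [measurableEquivRealProd, Complex.ext_iff]

theorem measurable_chord_lintegral {h : ℂ → ℝ≥0∞} (hh : Measurable h) :
    Measurable (fun p => ∫⁻ t in Ioc 0 (exitTime p), h (ray p t)) := by
  have hS : MeasurableSet {q : (ℝ × ℝ) × ℝ | 0 < q.2 ∧ q.2 ≤ exitTime q.1} :=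
    (measurableSet_lt measurable_const measurable_snd).inter
      (measurableSet_le measurable_snd (measurable_exitTime.comp measurable_fst))
  have := Measurable.lintegral_prod_right' (ν := (volume : Measure ℝ))
    ((hh.comp measurable_ray).indicator hS)
  convert this using 2 with p
  rw [← lintegral_indicator measurableSet_Ioc]
  rfl

/-- The integral over all chords, weighted by `cos α`, is controlled by the integral over the
disk. -/
theorem lintegral_chords_le {h : ℂ → ℝ≥0∞} (hh : Measurable h) :
    ∫⁻ p, ENNReal.ofReal (Real.cos p.2) * (∫⁻ t in Ioc 0 (exitTime p), h (ray p t)) ∂fanMeasure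
      ≤ ENNReal.ofReal (4 * π) * ∫⁻ z, h z ∂diskMeasure := by
  set g : ℂ → ℝ≥0∞ := disk.indicator h with hg_def
  have hg : Measurable g := hh.indicator measurableSet_disk
  have hG := measurable_lineIntegral hg
  have step1 : ∀ p : ℝ × ℝ, ∫⁻ t in Ioc 0 (exitTime p), h (ray p t)
      ≤ lineIntegral g (p.1 + p.2) (Real.sin p.2) := by
    intro p
    calc ∫⁻ t in Ioc 0 (exitTime p), h (ray p t)
        = ∫⁻ t in Ioc 0 (exitTime p), g (ray p t) := by
          refine setLIntegral_congr_fun measurableSet_Ioc fun t ht => ?_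
          simp only [hg_def]
          rw [indicator_of_mem ((ray_mem_disk_iff ht.1).2 ht.2)]
      _ ≤ ∫⁻ t, g (ray p t) := setLIntegral_le_lintegral _ _
      _ = lineIntegral g (p.1 + p.2) (Real.sin p.2) := by
          simp only [ray_eq]
          exact lintegral_sub_left_eq_self (μ := volume) (fun u : ℝ =>
            g (exp (I * (p.1 + p.2 : ℝ)) * ((u : ℂ) - Real.sin p.2 * I))) (Real.cos p.2)
  have hmeas : Measurable (fun p : ℝ × ℝ =>
      ENNReal.ofReal (Real.cos p.2) * lineIntegral g (p.1 + p.2) (Real.sin p.2)) := by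
    refine Measurable.mul (by fun_prop) (hG.comp (g := fun q : ℝ × ℝ => lineIntegral g q.1 q.2)
      (f := fun p : ℝ × ℝ => (p.1 + p.2, Real.sin p.2)) (by fun_prop))
  calc _ ≤ ∫⁻ p, ENNReal.ofReal (Real.cos p.2) * lineIntegral g (p.1 + p.2) (Real.sin p.2)
        ∂fanMeasure := by
        refine lintegral_mono fun p => ?_
        gcongr
        exact step1 p
    _ = ∫⁻ α in Ioo (-(π / 2)) (π / 2), ∫⁻ β in Ioc (-π) π,
          ENNReal.ofReal (Real.cos α) * lineIntegral g (β + α) (Real.sin α) := by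
        rw [fanMeasure, fan, Measure.volume_eq_prod, ← Measure.prod_restrict,
          lintegral_prod_symm' _ hmeas]
    _ ≤ ∫⁻ α in Ioo (-(π / 2)) (π / 2), ∫⁻ θ in Ioc (-(2 * π)) (2 * π),
          ENNReal.ofReal (Real.cos α) * lineIntegral g θ (Real.sin α) := by
        refine setLIntegral_mono' measurableSet_Ioo fun α hα => ?_
        rw [← lintegral_indicator measurableSet_Ioc, ← lintegral_indicator measurableSet_Ioc,
          ← lintegral_add_right_eq_self (μ := volume) ((Ioc (-(2 * π)) (2 * π)).indicator _) α]
        refine lintegral_mono fun β => ?_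
        by_cases hβ : β ∈ Ioc (-π) π
        · have : β + α ∈ Ioc (-(2 * π)) (2 * π) := by
            constructor <;> linarith [hβ.1, hβ.2, hα.1, hα.2, Real.pi_pos]
          rw [indicator_of_mem hβ, indicator_of_mem this]
        · rw [indicator_of_notMem hβ]
          exact zero_le
    _ = ∫⁻ θ in Ioc (-(2 * π)) (2 * π), ∫⁻ α in Ioo (-(π / 2)) (π / 2),
          ENNReal.ofReal (Real.cos α) * lineIntegral g θ (Real.sin α) := by
        refine lintegral_lintegral_swap (Measurable.aemeasurable ?_)
        refine Measurable.mul (by fun_prop) (hG.comp (g := fun q : ℝ × ℝ => lineIntegral g q.1 q.2)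
          (f := fun p : ℝ × ℝ => (p.2, Real.sin p.1)) (by fun_prop))
    _ ≤ ∫⁻ θ in Ioc (-(2 * π)) (2 * π), ∫⁻ z, g z := by
        refine lintegral_mono fun θ => ?_
        rw [← lintegral_lineIntegral hg θ]
        calc _ = ∫⁻ α in Ioo (-(π / 2)) (π / 2),
              ENNReal.ofReal |Real.cos α| * lineIntegral g θ (Real.sin α) := by
              refine setLIntegral_congr_fun measurableSet_Ioo fun α hα => ?_
              rw [abs_of_pos (Real.cos_pos_of_mem_Ioo hα)]
          _ = ∫⁻ s in Real.sin '' Ioo (-(π / 2)) (π / 2), lineIntegral g θ s :=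
              (lintegral_image_eq_lintegral_abs_deriv_mul measurableSet_Ioo
                (fun α _ => (Real.hasDerivAt_sin α).hasDerivWithinAt)
                (Real.injOn_sin.mono Ioo_subset_Icc_self) _).symm
          _ ≤ _ := setLIntegral_le_lintegral _ _
    _ = ENNReal.ofReal (4 * π) * ∫⁻ z, h z ∂diskMeasure := by
        rw [setLIntegral_const, Real.volume_Ioc, hg_def, lintegral_indicator measurableSet_disk,
          mul_comm, diskMeasure]
        congr 2
        ring

/-- A property that holds almost everywhere on the disk holds almost everywhere on almost every
chord. -/
theorem ae_ray_of_ae {P : ℂ → Prop} (hP : ∀ᵐ z ∂diskMeasure, P z) :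
    ∀ᵐ p ∂fanMeasure, ∀ᵐ t ∂(volume.restrict (Ioc 0 (exitTime p))), P (ray p t) := by
  obtain ⟨N, hN, hNm, hN0⟩ := exists_measurable_superset_of_null hP
  have hm : Measurable (N.indicator (fun _ : ℂ => (1 : ℝ≥0∞))) := measurable_const.indicator hNm
  have h0 := lintegral_chords_le hm
  rw [lintegral_indicator hNm, setLIntegral_const, hN0, mul_zero, mul_zero, nonpos_iff_eq_zero,
    lintegral_eq_zero_iff' (by
      exact (Measurable.mul (by fun_prop) (measurable_chord_lintegral hm)).aemeasurable)] at h0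
  have hfan : ∀ᵐ p ∂fanMeasure, p ∈ fan := ae_restrict_mem measurableSet_fan
  filter_upwards [h0, hfan] with p hp hpf
  have hp2 : ∫⁻ t in Ioc 0 (exitTime p), N.indicator (fun _ : ℂ => (1 : ℝ≥0∞)) (ray p t) = 0 := by
    rcases mul_eq_zero.1 hp with h | h
    · exact absurd h (by simpa using cos_pos_of_mem_fan hpf)
    · exact h
  have hmp : Measurable (fun t : ℝ => N.indicator (fun _ : ℂ => (1 : ℝ≥0∞)) (ray p t)) :=
    hm.comp (measurable_ray.comp (measurable_const.prodMk measurable_id))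
  rw [lintegral_eq_zero_iff hmp] at hp2
  filter_upwards [hp2] with t ht
  by_contra hc
  have : ray p t ∈ N := hN hc
  simp [this] at ht

theorem stronglyMeasurable_xray {f : ℂ → ℂ} (hf : StronglyMeasurable f) :
    AEStronglyMeasurable (xray f) fanMeasure := by
  have hS : MeasurableSet {q : (ℝ × ℝ) × ℝ | 0 < q.2 ∧ q.2 ≤ exitTime q.1} :=
    (measurableSet_lt measurable_const measurable_snd).inter
      (measurableSet_le measurable_snd (measurable_exitTime.comp measurable_fst))
  have h := StronglyMeasurable.integral_prod_right' (ν := (volume : Measure ℝ))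
    ((hf.comp_measurable measurable_ray).indicator hS)
  refine h.aestronglyMeasurable.congr ?_
  filter_upwards [ae_restrict_mem measurableSet_fan] with p hp
  have hτ : 0 ≤ exitTime p := by
    have := cos_pos_of_mem_fan hp
    rw [exitTime]
    linarith
  rw [xray, intervalIntegral.integral_of_le hτ, ← integral_indicator measurableSet_Ioc]
  rfl

theorem lintegral_sq_le (μ : Measure ℝ) {φ : ℝ → ℝ≥0∞} (hφ : Measurable φ) :
    (∫⁻ t, φ t ∂μ) ^ 2 ≤ μ univ * ∫⁻ t, φ t ^ 2 ∂μ := by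
  have h := ENNReal.lintegral_mul_le_Lp_mul_Lq μ Real.HolderConjugate.two_two
    (f := fun _ => 1) (g := φ) aemeasurable_const hφ.aemeasurable
  simp only [Pi.mul_apply, one_mul, lintegral_const, ENNReal.rpow_two, one_pow] at h
  calc (∫⁻ t, φ t ∂μ) ^ 2
      ≤ (μ univ ^ (1 / 2 : ℝ) * (∫⁻ t, φ t ^ 2 ∂μ) ^ (1 / 2 : ℝ)) ^ 2 := by gcongr
    _ = μ univ * ∫⁻ t, φ t ^ 2 ∂μ := by
        rw [mul_pow, ← ENNReal.rpow_two, ← ENNReal.rpow_two, ← ENNReal.rpow_mul,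
          ← ENNReal.rpow_mul]
        norm_num

theorem exitTime_pos {p : ℝ × ℝ} (hp : p ∈ fan) : 0 < exitTime p := by
  have := cos_pos_of_mem_fan hp
  rw [exitTime]
  linarith

theorem lintegral_enorm_xray_sq_le {f : ℂ → ℂ} (hf : StronglyMeasurable f) :
    ∫⁻ p, ‖xray f p‖ₑ ^ 2 ∂fanMeasure
      ≤ ENNReal.ofReal (8 * π) * ∫⁻ z, ‖f z‖ₑ ^ 2 ∂diskMeasure := by
  have hm : Measurable (fun z => ‖f z‖ₑ ^ 2) := hf.measurable.enorm.pow_const 2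
  calc ∫⁻ p, ‖xray f p‖ₑ ^ 2 ∂fanMeasure
      ≤ ∫⁻ p, 2 * (ENNReal.ofReal (Real.cos p.2) *
          (∫⁻ t in Ioc 0 (exitTime p), ‖f (ray p t)‖ₑ ^ 2)) ∂fanMeasure := by
        refine lintegral_mono_ae ?_
        filter_upwards [ae_restrict_mem measurableSet_fan] with p hp
        have hmp : Measurable (fun t : ℝ => ‖f (ray p t)‖ₑ) :=
          hf.measurable.enorm.comp
            (measurable_ray.comp (measurable_const.prodMk measurable_id))
        have h2 := lintegral_sq_le (volume.restrict (Ioc 0 (exitTime p))) hmp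
        rw [Measure.restrict_apply_univ, Real.volume_Ioc, sub_zero, exitTime,
          ENNReal.ofReal_mul (by norm_num), ENNReal.ofReal_ofNat, mul_assoc] at h2
        refine le_trans ?_ h2
        gcongr
        rw [xray, intervalIntegral.integral_of_le (exitTime_pos hp).le]
        exact enorm_integral_le_lintegral_enorm _
    _ = 2 * ∫⁻ p, (ENNReal.ofReal (Real.cos p.2) *
          (∫⁻ t in Ioc 0 (exitTime p), ‖f (ray p t)‖ₑ ^ 2)) ∂fanMeasure := by
        rw [lintegral_const_mul' _ _ (by norm_num)]
    _ ≤ 2 * (ENNReal.ofReal (4 * π) * ∫⁻ z, ‖f z‖ₑ ^ 2 ∂diskMeasure) := by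
        gcongr
        exact lintegral_chords_le hm
    _ = _ := by
        rw [← mul_assoc]
        congr 1
        rw [show (8 : ℝ) * π = 2 * (4 * π) by ring,
          ENNReal.ofReal_mul (p := 2) (q := 4 * π) (by norm_num), ENNReal.ofReal_ofNat]

theorem eLpNorm_two_eq {X : Type*} [MeasurableSpace X] (μ : Measure X) (f : X → ℂ) :
    eLpNorm f 2 μ = (∫⁻ x, ‖f x‖ₑ ^ 2 ∂μ) ^ (1 / 2 : ℝ) := by
  rw [eLpNorm_eq_lintegral_rpow_enorm_toReal (by norm_num) (by norm_num)]
  simp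

theorem eLpNorm_xray_le {f : ℂ → ℂ} (hf : StronglyMeasurable f) :
    eLpNorm (xray f) 2 fanMeasure
      ≤ ENNReal.ofReal (√(8 * π)) * eLpNorm f 2 diskMeasure := by
  rw [eLpNorm_two_eq, eLpNorm_two_eq, Real.sqrt_eq_rpow,
    ← ENNReal.ofReal_rpow_of_nonneg (by positivity) (by norm_num),
    ← ENNReal.mul_rpow_of_nonneg _ _ (by norm_num)]
  gcongr
  exact lintegral_enorm_xray_sq_le hf

theorem memLp_xray {f : ℂ → ℂ} (hf : StronglyMeasurable f) (hf2 : MemLp f 2 diskMeasure) :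
    MemLp (xray f) 2 fanMeasure :=
  ⟨stronglyMeasurable_xray hf,
    (eLpNorm_xray_le hf).trans_lt (ENNReal.mul_lt_top ENNReal.ofReal_lt_top hf2.2)⟩

/-- An `L²` function is integrable along almost every chord. -/
theorem ae_intervalIntegrable {f : ℂ → ℂ} (hf : StronglyMeasurable f)
    (hf2 : MemLp f 2 diskMeasure) :
    ∀ᵐ p ∂fanMeasure, IntervalIntegrable (fun t => f (ray p t)) volume 0 (exitTime p) := by
  have hm : Measurable (fun z => ‖f z‖ₑ) := hf.measurable.enorm
  have h1 : ∫⁻ z, ‖f z‖ₑ ∂diskMeasure < ⊤ := (hf2.integrable (by norm_num)).2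
  have h2 := (lintegral_chords_le hm).trans_lt (ENNReal.mul_lt_top ENNReal.ofReal_lt_top h1)
  have h3 := ae_lt_top (Measurable.mul (by fun_prop) (measurable_chord_lintegral hm)) h2.ne
  filter_upwards [h3, ae_restrict_mem measurableSet_fan] with p hp hpf
  rw [intervalIntegrable_iff_integrableOn_Ioc_of_le (exitTime_pos hpf).le]
  refine ⟨(hf.comp_measurable
    (measurable_ray.comp (measurable_const.prodMk measurable_id))).aestronglyMeasurable, ?_⟩
  rcases ENNReal.mul_lt_top_iff.1 hp with h | h | h
  · exact h.2
  · exact absurd h (by simpa using cos_pos_of_mem_fan hpf)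
  · exact h.trans_lt (by simp)

theorem xray_congr_ae {f g : ℂ → ℂ} (h : f =ᵐ[diskMeasure] g) :
    xray f =ᵐ[fanMeasure] xray g := by
  filter_upwards [ae_ray_of_ae h, ae_restrict_mem measurableSet_fan] with p hp hpf
  rw [xray, xray, intervalIntegral.integral_of_le (exitTime_pos hpf).le,
    intervalIntegral.integral_of_le (exitTime_pos hpf).le]
  exact integral_congr_ae hp

theorem memLp_xray_coe (u : L2Disk) : MemLp (xray u) 2 fanMeasure :=
  memLp_xray (Lp.stronglyMeasurable u) (Lp.memLp u)

/-- The X-ray transform `I₀ : L²(disk) → L²(inward boundary vectors, dβ dα)` as a bounded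
operator. -/
def I0 : L2Disk →L[ℂ] L2Fan :=
  LinearMap.mkContinuous
    { toFun := fun u => (memLp_xray_coe u).toLp (xray u)
      map_add' := by
        intro u v
        rw [← MemLp.toLp_add]
        refine MemLp.toLp_congr _ _ ((xray_congr_ae (Lp.coeFn_add u v)).trans ?_)
        filter_upwards [ae_intervalIntegrable (Lp.stronglyMeasurable u) (Lp.memLp u),
          ae_intervalIntegrable (Lp.stronglyMeasurable v) (Lp.memLp v)] with p hu hv
        exact intervalIntegral.integral_add hu hv
      map_smul' := by
        intro c u
        rw [RingHom.id_apply, ← MemLp.toLp_const_smul]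
        refine MemLp.toLp_congr _ _ ((xray_congr_ae (Lp.coeFn_smul c u)).trans ?_)
        refine Filter.Eventually.of_forall fun p => ?_
        exact intervalIntegral.integral_smul c _ }
    (√(8 * π))
    (by
      intro u
      change ‖(memLp_xray_coe u).toLp (xray u)‖ ≤ _
      rw [Lp.norm_toLp, Lp.norm_def, ← ENNReal.toReal_ofReal (Real.sqrt_nonneg (8 * π)),
        ← ENNReal.toReal_mul]
      exact ENNReal.toReal_mono
        (ENNReal.mul_ne_top ENNReal.ofReal_ne_top (Lp.memLp u).2.ne)
        (eLpNorm_xray_le (Lp.stronglyMeasurable u)))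

theorem coeFn_I0 (u : L2Disk) : I0 u =ᵐ[fanMeasure] xray u :=
  (memLp_xray_coe u).coeFn_toLp

/-- The adjoint `I₀*` of the X-ray transform between these two Hilbert spaces. -/
def I0star : L2Fan →L[ℂ] L2Disk := ContinuousLinearMap.adjoint I0

/-! ### The degenerate elliptic operator `𝓛` -/

/-- Smooth functions on the closed disk, up to the boundary. -/
def SmoothOnDisk (φ : ℂ → ℂ) : Prop := ContDiffOn ℝ ∞ φ disk

/-- The differential operator `𝓛 = -L + 1` with
`L = (1-ρ²) ∂ρ² + (1/ρ - 3ρ) ∂ρ + ρ⁻² ∂θ²` in polar coordinates, written in Cartesian coordinates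
so that it makes sense on the whole closed disk: `L φ (z) = Δφ(z) - D²φ(z)(z, z) - 3 Dφ(z)(z)`.
At boundary points the derivatives are taken within the disk. The polar form is
`diskOp_eq_polar` below. -/
def diskOp (φ : ℂ → ℂ) (z : ℂ) : ℂ :=
  -(fderivWithin ℝ (fderivWithin ℝ φ disk) disk z 1 1
      + fderivWithin ℝ (fderivWithin ℝ φ disk) disk z I I
      - fderivWithin ℝ (fderivWithin ℝ φ disk) disk z z z
      - 3 * fderivWithin ℝ φ disk z z)
    + φ z

/-- `𝓛` in polar coordinates `z = ρ e^{iθ}`. -/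
theorem diskOp_eq_polar {φ : ℂ → ℂ} (hφ : SmoothOnDisk φ) {ρ θ : ℝ} (h0 : 0 < ρ) (h1 : ρ < 1) :
    diskOp φ (ρ * exp (θ * I)) =
      -((1 - ρ ^ 2) * iteratedDeriv 2 (fun r : ℝ => φ (r * exp (θ * I))) ρ
        + (1 / ρ - 3 * ρ) * deriv (fun r : ℝ => φ (r * exp (θ * I))) ρ
        + 1 / ρ ^ 2 * iteratedDeriv 2 (fun w : ℝ => φ (ρ * exp (w * I))) θ)
      + φ (ρ * exp (θ * I)) := by
  set e : ℂ := exp (θ * I) with he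
  set z : ℂ := ρ * e with hz
  have hnorm : ∀ r w : ℝ, ‖(r : ℂ) * exp (w * I)‖ = |r| := fun r w => by
    rw [norm_mul, norm_exp_ofReal_mul_I, mul_one, norm_real, Real.norm_eq_abs]
  have hnhds : ∀ y : ℂ, ‖y‖ < 1 → disk ∈ nhds y := fun y hy =>
    Metric.closedBall_mem_nhds_of_mem (by simpa using hy)
  have hC : ∀ y : ℂ, ‖y‖ < 1 → ContDiffAt ℝ 2 φ y := fun y hy =>
    (hφ.contDiffAt (hnhds y hy)).of_le
      (WithTop.coe_le_coe.2 (le_top : (2 : ℕ∞) ≤ ⊤))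
  have hD : ∀ y : ℂ, ‖y‖ < 1 → HasFDerivAt φ (fderiv ℝ φ y) y := fun y hy =>
    ((hC y hy).differentiableAt (by norm_num)).hasFDerivAt
  have hzn : ‖z‖ < 1 := by
    rw [hz, he, hnorm, abs_of_pos h0]
    exact h1
  have hB : HasFDerivAt (fderiv ℝ φ) (fderiv ℝ (fderiv ℝ φ) z) z :=
    (((hC z hzn).fderiv_right (m := 1) (by norm_num)).differentiableAt
      (by norm_num)).hasFDerivAt
  have hw1 : ∀ y : ℂ, ‖y‖ < 1 → fderivWithin ℝ φ disk y = fderiv ℝ φ y := fun y hy =>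
    fderivWithin_of_mem_nhds (hnhds y hy)
  have hw2 : fderivWithin ℝ (fderivWithin ℝ φ disk) disk z = fderiv ℝ (fderiv ℝ φ) z := by
    rw [fderivWithin_of_mem_nhds (hnhds z hzn)]
    refine Filter.EventuallyEq.fderiv_eq ?_
    filter_upwards [(isOpen_lt continuous_norm continuous_const).mem_nhds hzn] with y hy
    exact hw1 y hy
  generalize hBdef : fderiv ℝ (fderiv ℝ φ) z = B at hB hw2
  -- radial derivatives
  have hr : ∀ r : ℝ, HasDerivAt (fun r : ℝ => (r : ℂ) * e) e r := fun r => by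
    simpa using (hasDerivAt_id r).ofReal_comp.mul_const e
  have hφr : ∀ r : ℝ, |r| < 1 →
      HasDerivAt (fun r : ℝ => φ (r * e)) (fderiv ℝ φ (r * e) e) r := fun r hr1 =>
    (hD _ (by rw [he, hnorm]; exact hr1)).comp_hasDerivAt r (hr r)
  have hρ1 : |ρ| < 1 := by rwa [abs_of_pos h0]
  have d1 : deriv (fun r : ℝ => φ (r * e)) ρ = fderiv ℝ φ z e := (hφr ρ hρ1).deriv
  have d2 : iteratedDeriv 2 (fun r : ℝ => φ (r * e)) ρ = B e e := by
    rw [iteratedDeriv_succ, iteratedDeriv_one]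
    have hev : deriv (fun r : ℝ => φ (r * e)) =ᶠ[nhds ρ] fun r : ℝ => fderiv ℝ φ (r * e) e := by
      filter_upwards [(isOpen_lt continuous_abs continuous_const).mem_nhds hρ1] with r hr1
      exact (hφr r hr1).deriv
    rw [hev.deriv_eq]
    have hc : HasDerivAt (fun r : ℝ => fderiv ℝ φ (r * e)) (B e) ρ :=
      hB.comp_hasDerivAt ρ (hr ρ)
    have h2 : HasDerivAt (fun r : ℝ => fderiv ℝ φ (r * e) e)
        (B e e + fderiv ℝ φ (ρ * e) 0) ρ := hc.clm_apply (hasDerivAt_const ρ e)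
    rw [h2.deriv, map_zero, add_zero]
  -- angular derivatives
  have hw : ∀ w : ℝ, HasDerivAt (fun w : ℝ => (ρ : ℂ) * exp (w * I))
      (I * (ρ * exp (w * I))) w := fun w => by
    have e1 : I * ((ρ : ℂ) * exp (w * I)) = ρ * (exp (w * I) * (((1 : ℝ) : ℂ) * I)) := by
      push_cast
      ring
    rw [e1]
    exact (((hasDerivAt_id w).ofReal_comp.mul_const I).cexp).const_mul (ρ : ℂ)
  have hφw : ∀ w : ℝ, HasDerivAt (fun w : ℝ => φ (ρ * exp (w * I)))
      (fderiv ℝ φ (ρ * exp (w * I)) (I * (ρ * exp (w * I)))) w := fun w =>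
    (hD _ (by rw [hnorm]; exact hρ1)).comp_hasDerivAt w (hw w)
  have d3 : iteratedDeriv 2 (fun w : ℝ => φ (ρ * exp (w * I))) θ = B (I * z) (I * z) - fderiv ℝ φ z z := by
    rw [iteratedDeriv_succ, iteratedDeriv_one]
    have hev : deriv (fun w : ℝ => φ (ρ * exp (w * I))) =
        fun w : ℝ => fderiv ℝ φ (ρ * exp (w * I)) (I * (ρ * exp (w * I))) :=
      funext fun w => (hφw w).deriv
    rw [hev]
    have hc : HasDerivAt (fun w : ℝ => fderiv ℝ φ (ρ * exp (w * I))) (B (I * z)) θ :=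
      hB.comp_hasDerivAt θ (hw θ)
    have h2 : HasDerivAt
        (fun w : ℝ => fderiv ℝ φ (ρ * exp (w * I)) (I * (ρ * exp (w * I))))
        (B (I * z) (I * z) + fderiv ℝ φ z (I * (I * (ρ * exp (θ * I))))) θ :=
      hc.clm_apply ((hw θ).const_mul I)
    have h3 : I * (I * ((ρ : ℂ) * exp (θ * I))) = -z := by
      rw [← mul_assoc, I_mul_I, hz, he]
      ring
    rw [h2.deriv, h3, map_neg, ← sub_eq_add_neg]
  rw [d1, d2, d3, diskOp, hw2, hw1 z hzn]
  -- reduction to the coordinates of `e`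
  have hee : e = Real.cos θ • (1 : ℂ) + Real.sin θ • I := by
    rw [he, exp_mul_I]
    simp
  have hIe : I * e = (-Real.sin θ) • (1 : ℂ) + Real.cos θ • I := by
    rw [he, exp_mul_I]
    simp [Complex.ext_iff]
  have hzr : z = ρ • e := by simp [hz]
  have hIz : I * z = ρ • (I * e) := by
    rw [hz]
    simp
    ring
  have htr : B 1 1 + B I I = B e e + B (I * e) (I * e) := by
    rw [hIe, hee]
    simp only [map_add, map_smul, add_apply, smul_apply]
    simp only [real_smul]
    have hcs : (Real.cos θ : ℂ) ^ 2 + (Real.sin θ : ℂ) ^ 2 = 1 := by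
      exact_mod_cast Real.cos_sq_add_sin_sq θ
    push_cast at hcs ⊢
    linear_combination (-(B 1 1) - B I I) * hcs
  have hρ0 : (ρ : ℂ) ≠ 0 := by exact_mod_cast h0.ne'
  rw [htr, hIz, hzr]
  simp only [map_smul, smul_apply]
  simp only [real_smul]
  field_simp
  ring

theorem uniqueDiffOn_disk : UniqueDiffOn ℝ disk :=
  uniqueDiffOn_convex (convex_closedBall _ _) (by
    rw [disk, interior_closedBall _ one_ne_zero]
    exact ⟨0, by simp⟩)

theorem disk_subset_closure_interior : disk ⊆ closure (interior disk) := by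
  rw [disk, interior_closedBall _ one_ne_zero, closure_ball _ one_ne_zero]

theorem SmoothOnDisk.fderivWithin {φ : ℂ → ℂ} (hφ : SmoothOnDisk φ) :
    ContDiffOn ℝ ∞ (fderivWithin ℝ φ disk) disk :=
  ContDiffOn.fderivWithin hφ uniqueDiffOn_disk (by simp)

theorem SmoothOnDisk.fderivWithin_two {φ : ℂ → ℂ} (hφ : SmoothOnDisk φ) :
    ContDiffOn ℝ ∞ (_root_.fderivWithin ℝ (_root_.fderivWithin ℝ φ disk) disk) disk :=
  ContDiffOn.fderivWithin hφ.fderivWithin uniqueDiffOn_disk (by simp)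

/-- `𝓛` maps smooth functions on the closed disk to smooth functions on the closed disk. -/
theorem SmoothOnDisk.diskOp {φ : ℂ → ℂ} (hφ : SmoothOnDisk φ) : SmoothOnDisk (diskOp φ) := by
  have h1 := hφ.fderivWithin
  have h2 := hφ.fderivWithin_two
  have hid : ContDiffOn ℝ ∞ (fun z : ℂ => z) disk := contDiffOn_id
  refine ContDiffOn.add (ContDiffOn.neg (ContDiffOn.sub (ContDiffOn.sub (ContDiffOn.add ?_ ?_) ?_)
    (ContDiffOn.mul contDiffOn_const ?_))) hφ
  · exact (h2.clm_apply contDiffOn_const).clm_apply contDiffOn_const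
  · exact (h2.clm_apply contDiffOn_const).clm_apply contDiffOn_const
  · exact (h2.clm_apply hid).clm_apply hid
  · exact h1.clm_apply hid

theorem diskOp_congr {φ ψ : ℂ → ℂ} (h : EqOn φ ψ disk) : EqOn (diskOp φ) (diskOp ψ) disk := by
  have h1 : EqOn (fderivWithin ℝ φ disk) (fderivWithin ℝ ψ disk) disk := fun z hz =>
    fderivWithin_congr h (h hz)
  intro z hz
  rw [diskOp, diskOp, h1 hz, fderivWithin_congr h1 (h1 hz), h hz]

theorem diskOp_add {φ ψ : ℂ → ℂ} (hφ : SmoothOnDisk φ) (hψ : SmoothOnDisk ψ) :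
    EqOn (diskOp (φ + ψ)) (diskOp φ + diskOp ψ) disk := by
  have h1 : EqOn (fderivWithin ℝ (φ + ψ) disk)
      (fderivWithin ℝ φ disk + fderivWithin ℝ ψ disk) disk := fun z hz =>
    fderivWithin_add (uniqueDiffOn_disk z hz) (hφ.differentiableOn (by simp) z hz)
      (hψ.differentiableOn (by simp) z hz)
  intro z hz
  have h2 := fderivWithin_add (uniqueDiffOn_disk z hz)
    (hφ.fderivWithin.differentiableOn (by simp) z hz)
    (hψ.fderivWithin.differentiableOn (by simp) z hz)
  rw [Pi.add_apply, diskOp, diskOp, diskOp, h1 hz, fderivWithin_congr h1 (h1 hz), h2]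
  simp only [Pi.add_apply, add_apply]
  ring

theorem diskOp_smul (c : ℂ) {φ : ℂ → ℂ} (hφ : SmoothOnDisk φ) :
    EqOn (diskOp (c • φ)) (c • diskOp φ) disk := by
  have h1 : EqOn (fderivWithin ℝ (c • φ) disk) (c • fderivWithin ℝ φ disk) disk := fun z hz =>
    fderivWithin_const_smul (uniqueDiffOn_disk z hz) (hφ.differentiableOn (by simp) z hz) c
  intro z hz
  have h2 := fderivWithin_const_smul (uniqueDiffOn_disk z hz)
    (hφ.fderivWithin.differentiableOn (by simp) z hz) c
  rw [Pi.smul_apply, diskOp, diskOp, h1 hz, fderivWithin_congr h1 (h1 hz), h2]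
  simp only [Pi.smul_apply, smul_apply, smul_eq_mul]
  ring

theorem memLp_of_continuousOn {X : Type*} [TopologicalSpace X] [MeasureSpace X]
    [OpensMeasurableSpace X] [IsFiniteMeasureOnCompacts (volume : Measure X)]
    [SecondCountableTopology X] {K : Set X} (hK : IsCompact K) (hKm : MeasurableSet K)
    {f : X → ℂ} (hf : ContinuousOn f K) : MemLp f 2 (volume.restrict K) := by
  obtain ⟨C, hC⟩ := hK.exists_bound_of_continuousOn hf
  have : IsFiniteMeasure ((volume : Measure X).restrict K) :=
    ⟨by
      rw [Measure.restrict_apply_univ]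
      exact hK.measure_lt_top⟩
  refine MemLp.of_bound (hf.aestronglyMeasurable hKm) C ?_
  filter_upwards [ae_restrict_mem hKm] with x hx using hC x hx

theorem SmoothOnDisk.memLp {φ : ℂ → ℂ} (hφ : SmoothOnDisk φ) : MemLp φ 2 diskMeasure :=
  memLp_of_continuousOn (isCompact_closedBall 0 1) measurableSet_disk hφ.continuousOn

/-- The elements of `L²` of the disk that are represented by a smooth function on the closed
disk. -/
def smoothL2 : Submodule ℂ L2Disk where
  carrier := {u | ∃ φ : ℂ → ℂ, SmoothOnDisk φ ∧ u =ᵐ[diskMeasure] φ}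
  add_mem' := by
    rintro u v ⟨φ, hφ, hu⟩ ⟨ψ, hψ, hv⟩
    exact ⟨φ + ψ, ContDiffOn.add hφ hψ, (Lp.coeFn_add u v).trans (hu.add hv)⟩
  zero_mem' := ⟨0, contDiffOn_const, Lp.coeFn_zero _ _ _⟩
  smul_mem' := by
    rintro c u ⟨φ, hφ, hu⟩
    exact ⟨c • φ, ContDiffOn.const_smul c hφ, (Lp.coeFn_smul c u).trans (hu.const_smul c)⟩

/-- The smooth representative of an element of `smoothL2`. It is unique on the disk. -/
def smoothRep (u : smoothL2) : ℂ → ℂ := u.2.choose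

theorem smoothOnDisk_smoothRep (u : smoothL2) : SmoothOnDisk (smoothRep u) :=
  u.2.choose_spec.1

theorem coeFn_ae_eq_smoothRep (u : smoothL2) : (u : L2Disk) =ᵐ[diskMeasure] smoothRep u :=
  u.2.choose_spec.2

theorem eqOn_smoothRep {u : smoothL2} {φ : ℂ → ℂ} (hφ : SmoothOnDisk φ)
    (h : (u : L2Disk) =ᵐ[diskMeasure] φ) : EqOn (smoothRep u) φ disk :=
  Measure.eqOn_of_ae_eq ((coeFn_ae_eq_smoothRep u).symm.trans h)
    (smoothOnDisk_smoothRep u).continuousOn hφ.continuousOn disk_subset_closure_interior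

theorem ae_eq_of_eqOn_disk {f g : ℂ → ℂ} (h : EqOn f g disk) : f =ᵐ[diskMeasure] g := by
  filter_upwards [ae_restrict_mem measurableSet_disk] with z hz using h hz

/-- The operator `𝓛` on its initial domain, the smooth functions on the closed disk, as a densely
defined operator of `L²` of the disk. -/
def smoothOp : L2Disk →ₗ.[ℂ] L2Disk where
  domain := smoothL2
  toFun :=
    { toFun := fun u => (smoothOnDisk_smoothRep u).diskOp.memLp.toLp (diskOp (smoothRep u))
      map_add' := by
        intro u v
        rw [← MemLp.toLp_add]
        refine MemLp.toLp_congr _ _ (ae_eq_of_eqOn_disk ?_)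
        refine EqOn.trans (diskOp_congr (eqOn_smoothRep (ContDiffOn.add
          (smoothOnDisk_smoothRep u) (smoothOnDisk_smoothRep v)) ?_))
          (diskOp_add (smoothOnDisk_smoothRep u) (smoothOnDisk_smoothRep v))
        exact (Lp.coeFn_add _ _).trans
          ((coeFn_ae_eq_smoothRep u).add (coeFn_ae_eq_smoothRep v))
      map_smul' := by
        intro c u
        rw [RingHom.id_apply, ← MemLp.toLp_const_smul]
        refine MemLp.toLp_congr _ _ (ae_eq_of_eqOn_disk ?_)
        refine EqOn.trans (diskOp_congr (eqOn_smoothRep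
          (ContDiffOn.const_smul c (smoothOnDisk_smoothRep u)) ?_))
          (diskOp_smul c (smoothOnDisk_smoothRep u))
        exact (Lp.coeFn_smul _ _).trans ((coeFn_ae_eq_smoothRep u).const_smul c) }

/-- On a class represented by a smooth function `φ`, the operator is given by `𝓛 φ`. -/
theorem smoothOp_apply_ae_eq (u : smoothL2) {φ : ℂ → ℂ} (hφ : SmoothOnDisk φ)
    (h : (u : L2Disk) =ᵐ[diskMeasure] φ) : smoothOp u =ᵐ[diskMeasure] diskOp φ :=
  ((smoothOnDisk_smoothRep u).diskOp.memLp.coeFn_toLp).trans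
    (ae_eq_of_eqOn_disk (diskOp_congr (eqOn_smoothRep hφ h)))

/-- The unbounded operator `𝓛` of `L²` of the disk: the closure of the differential operator `𝓛`
on smooth functions on the closed disk. -/
def closedOp : L2Disk →ₗ.[ℂ] L2Disk := smoothOp.closure

/-! ### The Zernike polynomials -/

/-- The functions `ψ_{n,k}` of the fan-beam coordinates `(β, α)`. -/
def psi (n : ℕ) (k : ℤ) (p : ℝ × ℝ) : ℂ :=
  (-1) ^ n / (4 * π) * exp (I * ((n - 2 * k) * (p.1 + p.2)))
    * (exp (I * ((n + 1) * p.2)) + (-1) ^ n * exp (-(I * ((n + 1) * p.2))))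

theorem memLp_psi (n : ℕ) (k : ℤ) : MemLp (psi n k) 2 fanMeasure := by
  have hc : Continuous (psi n k) := by
    unfold psi
    fun_prop
  have hK : IsCompact (Icc (-π) π ×ˢ Icc (-(π / 2)) (π / 2)) := isCompact_Icc.prod isCompact_Icc
  refine (memLp_of_continuousOn hK hK.measurableSet hc.continuousOn).mono_measure ?_
  exact Measure.restrict_mono (prod_mono Ioc_subset_Icc_self Ioo_subset_Icc_self) le_rfl

/-- The class of `ψ_{n,k}` in `L²`. -/
def psiL2 (n : ℕ) (k : ℤ) : L2Fan := (memLp_psi n k).toLp (psi n k)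

/-- The Zernike polynomials `Z_{n,k} = I₀* ψ_{n,k}`, as elements of `L²` of the disk. -/
def zernike (n : ℕ) (k : ℤ) : L2Disk := I0star (psiL2 n k)

end DiskXray

end

/-! The operators are diagonalised together, with no use of orthogonality. In the coordinates `θ = β
+ α`, `s = sin α` (direction and signed offset of a chord) the measure `cos α dβ dα` becomes `dθ
ds`. Hence the adjoint of the X-ray transform sends `cos α · g(β + α, sin α)` to the backprojection
`z ↦ ∫ g(θ, offset θ z) dθ` (`I0star_ae_eq_backprojection`). Up to a constant, `ψ_{n,k}` is `cos α ·
e^{i(n-2k)(β+α)} U_n(sin α)`, with `U_n` the Chebyshev polynomial of the second kind (`psi_eq`), so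
`Z_{n,k}` is a superposition of the ridge polynomials `U_n(offset θ z)` weighted by `e^{i(n-2k)θ}`.

Two computations give the eigenvalues. On a ridge function, `𝓛` acts on the profile as an ordinary
differential operator, for which Chebyshev's equation gives the eigenvalue `(n+1)²`
(`diskOp_eval_offset`, `profileOp_chebyshev`). The integral of a Chebyshev ridge along a chord
splits into `2/(n+1) · cos α U_n(sin α)` and `U_n` of the cosine of the angle between the directions
(`integral_eval_U_chord`). The second factor is a trigonometric kernel that reproduces the modes `n
- 2k` with `0 ≤ k ≤ n`, so `I₀ Z_{n,k} = 4π/(n+1) ψ_{n,k}` (`xray_zernikeFun`).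

On each `Z_{n,k}` the identity is thus `(4π/(n+1))² (n+1)² = (4π)²`. It extends to `L²` because the
Zernike polynomials span a dense subspace (`dense_zernikeSpan`), `(I₀* I₀)²` is bounded, and the
closure of the graph of `𝓛` is a graph (`smoothOp_isClosable`). -/

noncomputable section

namespace DiskXray

/-! ### The operator `𝓛` is closable -/

/-- Smooth functions with compact support in the open unit disk. -/
structure IsTest (w : ℂ → ℂ) : Prop where
  contDiff : ContDiff ℝ ∞ w
  hasCompactSupport : HasCompactSupport w
  tsupport_subset : tsupport w ⊆ Metric.ball 0 1

theorem IsTest.integrable_mul {w φ : ℂ → ℂ} (hw : IsTest w)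
    (hφ : ContinuousOn φ (Metric.ball 0 1)) : Integrable (fun z => w z * φ z) := by
  have h1 : IntegrableOn (fun z => w z * φ z) (tsupport w) :=
    ContinuousOn.integrableOn_compact hw.hasCompactSupport
      (hw.contDiff.continuous.continuousOn.mul (hφ.mono hw.tsupport_subset))
  refine (integrableOn_iff_integrable_of_support_subset ?_).1 h1
  exact (Function.support_mul_subset_left _ _).trans (subset_tsupport _)

theorem IsTest.fderiv {w : ℂ → ℂ} (hw : IsTest w) (v : ℂ) :
    IsTest (fun z => fderiv ℝ w z v) where
  contDiff := (hw.contDiff.fderiv_right (m := ∞) (by simp)).clm_apply contDiff_const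
  hasCompactSupport := hw.hasCompactSupport.fderiv_apply ℝ v
  tsupport_subset := (tsupport_fderiv_apply_subset ℝ v).trans hw.tsupport_subset

theorem IsTest.mul_left {w c : ℂ → ℂ} (hw : IsTest w) (hc : ContDiff ℝ ∞ c) :
    IsTest (fun z => c z * w z) where
  contDiff := hc.mul hw.contDiff
  hasCompactSupport := hw.hasCompactSupport.mul_left
  tsupport_subset := (tsupport_mul_subset_right).trans hw.tsupport_subset

theorem IsTest.add {w w' : ℂ → ℂ} (hw : IsTest w) (hw' : IsTest w') :
    IsTest (fun z => w z + w' z) where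
  contDiff := hw.contDiff.add hw'.contDiff
  hasCompactSupport := hw.hasCompactSupport.add hw'.hasCompactSupport
  tsupport_subset := (tsupport_add w w').trans (union_subset hw.tsupport_subset hw'.tsupport_subset)

theorem contDiffOn_fderiv_apply {φ : ℂ → ℂ} (hφ : ContDiffOn ℝ ∞ φ (Metric.ball 0 1)) (v : ℂ) :
    ContDiffOn ℝ ∞ (fun z => fderiv ℝ φ z v) (Metric.ball 0 1) :=
  (hφ.fderiv_of_isOpen Metric.isOpen_ball (by simp)).clm_apply contDiffOn_const

/-- Since `w` is supported compactly inside the open disk, the integration by parts can take place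
on the whole plane: the values of `φ` and of its derivative outside the disk are multiplied by zero,
and there is no boundary term. -/
theorem IsTest.integral_mul_fderiv {w φ : ℂ → ℂ} (hw : IsTest w)
    (hφ : ContDiffOn ℝ ∞ φ (Metric.ball 0 1)) (v : ℂ) :
    ∫ z, w z * _root_.fderiv ℝ φ z v = -∫ z, _root_.fderiv ℝ w z v * φ z := by
  refine integral_mul_fderiv_eq_neg_fderiv_mul_of_integrable
    ((hw.fderiv v).integrable_mul hφ.continuousOn)
    (hw.integrable_mul (contDiffOn_fderiv_apply hφ v).continuousOn)
    (hw.integrable_mul hφ.continuousOn)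
    (fun z _ => hw.contDiff.differentiable (by simp) z) fun z hz => ?_
  exact (hφ.differentiableOn (by simp)).differentiableAt
    (Metric.isOpen_ball.mem_nhds (hw.tsupport_subset hz))

/-- An operator on smooth functions that can be transposed onto test functions. -/
def HasFormalAdjoint (T : (ℂ → ℂ) → ℂ → ℂ) : Prop :=
  ∀ w, IsTest w → ∃ w', IsTest w' ∧ ∀ φ, ContDiffOn ℝ ∞ φ (Metric.ball 0 1) →
    Integrable (fun z => w z * T φ z) ∧ ∫ z, w z * T φ z = ∫ z, w' z * φ z

/-- Closability only needs some transposed test function `w'` to exist. Closure under smooth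
multipliers, sums and directional derivatives therefore replaces an explicit formula for the
transpose of `𝓛`. -/
theorem hasFormalAdjoint_id : HasFormalAdjoint (fun φ => φ) := fun w hw =>
  ⟨w, hw, fun _ hφ => ⟨hw.integrable_mul hφ.continuousOn, rfl⟩⟩

theorem HasFormalAdjoint.mul {T : (ℂ → ℂ) → ℂ → ℂ} (hT : HasFormalAdjoint T) {c : ℂ → ℂ}
    (hc : ContDiff ℝ ∞ c) : HasFormalAdjoint (fun φ z => c z * T φ z) := by
  intro w hw
  obtain ⟨w', hw', h⟩ := hT _ (hw.mul_left hc)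
  have he : ∀ φ : ℂ → ℂ, (fun z => w z * (c z * T φ z)) = fun z => c z * w z * T φ z :=
    fun φ => by
      funext z
      ring
  refine ⟨w', hw', fun φ hφ => ?_⟩
  rw [he]
  exact h φ hφ

theorem HasFormalAdjoint.add {T S : (ℂ → ℂ) → ℂ → ℂ} (hT : HasFormalAdjoint T)
    (hS : HasFormalAdjoint S) : HasFormalAdjoint (fun φ z => T φ z + S φ z) := by
  intro w hw
  obtain ⟨w₁, hw₁, h₁⟩ := hT w hw
  obtain ⟨w₂, hw₂, h₂⟩ := hS w hw
  refine ⟨_, hw₁.add hw₂, fun φ hφ => ?_⟩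
  simp only [mul_add, add_mul]
  refine ⟨(h₁ φ hφ).1.add (h₂ φ hφ).1, ?_⟩
  rw [integral_add (h₁ φ hφ).1 (h₂ φ hφ).1, (h₁ φ hφ).2, (h₂ φ hφ).2,
    integral_add (hw₁.integrable_mul hφ.continuousOn) (hw₂.integrable_mul hφ.continuousOn)]

theorem HasFormalAdjoint.comp_fderiv {T : (ℂ → ℂ) → ℂ → ℂ} (hT : HasFormalAdjoint T) (v : ℂ) :
    HasFormalAdjoint (fun φ => T (fun z => fderiv ℝ φ z v)) := by
  intro w hw
  obtain ⟨w', hw', h⟩ := hT w hw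
  refine ⟨_, (hw'.fderiv v).mul_left (contDiff_const (c := -1)), fun φ hφ => ?_⟩
  obtain ⟨h1, h2⟩ := h _ (contDiffOn_fderiv_apply hφ v)
  refine ⟨h1, ?_⟩
  rw [h2, hw'.integral_mul_fderiv hφ v, ← integral_neg]
  congr 1
  funext z
  ring

/-- The operator `𝓛` in the interior of the disk, in Cartesian coordinates. -/
def interiorOp (φ : ℂ → ℂ) (z : ℂ) : ℂ :=
  ((((((z.re : ℂ) ^ 2 - 1) * fderiv ℝ (fun y => fderiv ℝ φ y 1) z 1
    + ((z.im : ℂ) ^ 2 - 1) * fderiv ℝ (fun y => fderiv ℝ φ y I) z I)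
    + (z.re * z.im : ℂ) * fderiv ℝ (fun y => fderiv ℝ φ y I) z 1)
    + (z.re * z.im : ℂ) * fderiv ℝ (fun y => fderiv ℝ φ y 1) z I)
    + (3 * z.re : ℂ) * fderiv ℝ φ z 1)
    + (3 * z.im : ℂ) * fderiv ℝ φ z I
    + φ z

theorem contDiff_ofReal_re : ContDiff ℝ ∞ (fun z : ℂ => (z.re : ℂ)) :=
  (ofRealCLM.comp reCLM).contDiff

theorem contDiff_ofReal_im : ContDiff ℝ ∞ (fun z : ℂ => (z.im : ℂ)) :=
  (ofRealCLM.comp imCLM).contDiff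

theorem hasFormalAdjoint_interiorOp : HasFormalAdjoint interiorOp := by
  have h1 : ∀ v, HasFormalAdjoint (fun φ z => fderiv ℝ φ z v) := fun v =>
    hasFormalAdjoint_id.comp_fderiv v
  have h2 : ∀ u v, HasFormalAdjoint (fun φ z => fderiv ℝ (fun y => fderiv ℝ φ y v) z u) :=
    fun u v => (h1 u).comp_fderiv v
  have hx := contDiff_ofReal_re
  have hy := contDiff_ofReal_im
  exact ((((((h2 1 1).mul ((hx.pow 2).sub contDiff_const)).add
    ((h2 I I).mul ((hy.pow 2).sub contDiff_const))).add
    ((h2 1 I).mul (hx.mul hy))).add ((h2 I 1).mul (hx.mul hy))).add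
    ((h1 1).mul (contDiff_const.mul hx))).add ((h1 I).mul (contDiff_const.mul hy))
    |>.add hasFormalAdjoint_id

/-! ### Agreement of the two forms of `𝓛` in the open disk, and closability. -/

theorem disk_mem_nhds {z : ℂ} (hz : z ∈ Metric.ball (0 : ℂ) 1) : disk ∈ nhds z :=
  Metric.closedBall_mem_nhds_of_mem hz

theorem SmoothOnDisk.contDiffOn_ball {φ : ℂ → ℂ} (hφ : SmoothOnDisk φ) :
    ContDiffOn ℝ ∞ φ (Metric.ball 0 1) :=
  ContDiffOn.mono hφ Metric.ball_subset_closedBall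

theorem fderivWithin_disk_of_mem_ball {F : Type*} [NormedAddCommGroup F] [NormedSpace ℝ F]
    {φ : ℂ → F} {z : ℂ} (hz : z ∈ Metric.ball (0 : ℂ) 1) :
    _root_.fderivWithin ℝ φ disk z = _root_.fderiv ℝ φ z :=
  fderivWithin_of_mem_nhds (disk_mem_nhds hz)

theorem fderivWithin_two_disk_of_mem_ball {φ : ℂ → ℂ} {z : ℂ}
    (hz : z ∈ Metric.ball (0 : ℂ) 1) :
    _root_.fderivWithin ℝ (_root_.fderivWithin ℝ φ disk) disk z
      = _root_.fderiv ℝ (_root_.fderiv ℝ φ) z := by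
  rw [fderivWithin_disk_of_mem_ball hz]
  refine Filter.EventuallyEq.fderiv_eq ?_
  filter_upwards [Metric.isOpen_ball.mem_nhds hz] with y hy
  exact fderivWithin_disk_of_mem_ball hy

theorem SmoothOnDisk.diskOp_eq_interiorOp {φ : ℂ → ℂ} (hφ : SmoothOnDisk φ) {z : ℂ}
    (hz : z ∈ Metric.ball (0 : ℂ) 1) : DiskXray.diskOp φ z = interiorOp φ z := by
  have hd : DifferentiableAt ℝ (_root_.fderiv ℝ φ) z :=
    ((hφ.contDiffOn_ball.fderiv_of_isOpen Metric.isOpen_ball (m := ∞) (by simp)).differentiableOn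
      (by simp)).differentiableAt (Metric.isOpen_ball.mem_nhds hz)
  have h2 : ∀ u v, _root_.fderiv ℝ (fun y => _root_.fderiv ℝ φ y v) z u
      = _root_.fderiv ℝ (_root_.fderiv ℝ φ) z u v := by
    intro u v
    rw [fderiv_clm_apply hd (differentiableAt_const v)]
    simp
  have hzz : z = z.re • (1 : ℂ) + z.im • I := by
    simp [re_add_im]
  rw [DiskXray.diskOp, interiorOp, fderivWithin_two_disk_of_mem_ball hz,
    fderivWithin_disk_of_mem_ball hz]
  simp only [h2]
  generalize _root_.fderiv ℝ (_root_.fderiv ℝ φ) z = B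
  generalize _root_.fderiv ℝ φ z = A
  -- Both mixed terms are kept, as in `interiorOp`, so the symmetry of the second derivative is not
  -- needed.
  have hB : B z z = z.re * (z.re * B 1 1 + z.im * B 1 I) + z.im * (z.re * B I 1 + z.im * B I I) := by
    conv_lhs => rw [hzz]
    simp only [map_add, map_smul, add_apply, smul_apply]
    simp only [real_smul]
    ring
  have hA : A z = z.re * A 1 + z.im * A I := by
    conv_lhs => rw [hzz]
    rw [map_add, map_smul, map_smul, real_smul, real_smul]
  rw [hB, hA]
  ring

theorem diskMeasure_eq_restrict_ball : diskMeasure = volume.restrict (Metric.ball 0 1) := by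
  rw [diskMeasure, disk]
  refine Measure.restrict_congr_set ?_
  rw [← Metric.ball_union_sphere]
  exact union_ae_eq_left_of_ae_eq_empty
    (ae_eq_empty.2 (Measure.addHaar_sphere volume 0 1))

theorem IsTest.setIntegral_mul {w : ℂ → ℂ} (hw : IsTest w) (φ : ℂ → ℂ) :
    ∫ z, w z * φ z ∂diskMeasure = ∫ z, w z * φ z := by
  rw [diskMeasure_eq_restrict_ball]
  refine setIntegral_eq_integral_of_forall_compl_eq_zero fun z hz => ?_
  rw [image_eq_zero_of_notMem_tsupport fun h => hz (hw.tsupport_subset h), zero_mul]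

theorem IsTest.exists_integral_diskOp {w : ℂ → ℂ} (hw : IsTest w) :
    ∃ w', IsTest w' ∧ ∀ φ, SmoothOnDisk φ →
      ∫ z, w z * diskOp φ z ∂diskMeasure = ∫ z, w' z * φ z ∂diskMeasure := by
  obtain ⟨w', hw', h⟩ := hasFormalAdjoint_interiorOp w hw
  refine ⟨w', hw', fun φ hφ => ?_⟩
  rw [hw'.setIntegral_mul, ← (h φ hφ.contDiffOn_ball).2, ← hw.setIntegral_mul,
    diskMeasure_eq_restrict_ball]
  refine setIntegral_congr_fun measurableSet_ball fun z hz => ?_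
  simp only [hφ.diskOp_eq_interiorOp hz]

theorem IsTest.memLp_conj {w : ℂ → ℂ} (hw : IsTest w) :
    MemLp (fun z => (starRingEnd ℂ) (w z)) 2 diskMeasure :=
  memLp_of_continuousOn (isCompact_closedBall 0 1) measurableSet_disk
    (continuous_conj.comp hw.contDiff.continuous).continuousOn

theorem inner_toLp_left {f : ℂ → ℂ} (hf : MemLp f 2 diskMeasure) (u : L2Disk) :
    inner ℂ (hf.toLp f) u = ∫ z, u z * (starRingEnd ℂ) (f z) ∂diskMeasure := by
  rw [L2.inner_def]
  refine integral_congr_ae ?_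
  filter_upwards [hf.coeFn_toLp] with z hz
  rw [hz]
  rfl

/-- Conjugating `w` turns the sesquilinear inner product into the bilinear pairing in which
integrations by parts are expressed. -/
theorem IsTest.inner_conj {w : ℂ → ℂ} (hw : IsTest w) (u : L2Disk) :
    inner ℂ (hw.memLp_conj.toLp _) u = ∫ z, w z * u z ∂diskMeasure := by
  rw [inner_toLp_left]
  simp only [RingHomCompTriple.comp_apply, RingHom.id_apply, mul_comm]

/-- The closure of the graph is a graph as soon as `(0, y)` in it forces `y = 0`. For each test
function `w`, the relation `∫ w 𝓛φ = ∫ w' φ` is a closed condition on pairs in `L²`, so it persists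
in the closure of the graph. At `(0, y)` it says that `y` is orthogonal to all test functions. -/
theorem smoothOp_isClosable : smoothOp.IsClosable := by
  refine ⟨smoothOp.graph.topologicalClosure.toLinearPMap,
    (Submodule.toLinearPMap_graph_eq _ fun x hx hx1 => ?_).symm⟩
  have key : ∀ w, IsTest w → ∫ z, w z * x.2 z ∂diskMeasure = 0 := by
    intro w hw
    obtain ⟨w', hw', h⟩ := hw.exists_integral_diskOp
    have hsub : (smoothOp.graph.topologicalClosure : Set (L2Disk × L2Disk)) ⊆
        {y | inner ℂ (hw.memLp_conj.toLp _) y.2 = inner ℂ (hw'.memLp_conj.toLp _) y.1} := by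
      refine closure_minimal ?_ (isClosed_eq (by fun_prop) (by fun_prop))
      rintro ⟨a, b⟩ hab
      obtain ⟨u, hu1, hu2⟩ := (LinearPMap.mem_graph_iff _).1 hab
      simp only at hu1 hu2
      subst hu1 hu2
      simp only [mem_ofPred_eq, hw.inner_conj, hw'.inner_conj]
      have e1 := smoothOp_apply_ae_eq u (smoothOnDisk_smoothRep u) (coeFn_ae_eq_smoothRep u)
      have e2 := coeFn_ae_eq_smoothRep u
      calc ∫ z, w z * smoothOp u z ∂diskMeasure
          = ∫ z, w z * diskOp (smoothRep u) z ∂diskMeasure :=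
            integral_congr_ae (e1.mono fun z hz => congrArg (w z * ·) hz)
        _ = ∫ z, w' z * smoothRep u z ∂diskMeasure := h _ (smoothOnDisk_smoothRep u)
        _ = _ := integral_congr_ae (e2.mono fun z hz => congrArg (w' z * ·) hz.symm)
    have := hsub hx
    simp only [mem_ofPred_eq, hx1, inner_zero_right, hw.inner_conj] at this
    exact this
  have hloc : LocallyIntegrableOn (x.2 : ℂ → ℂ) (Metric.ball 0 1) volume := by
    refine IntegrableOn.locallyIntegrableOn ?_
    rw [IntegrableOn, ← diskMeasure_eq_restrict_ball]
    exact (Lp.memLp x.2).integrable (by norm_num)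
  -- Real-valued test functions suffice for this vanishing criterion.
  have h0 := Metric.isOpen_ball.ae_eq_zero_of_integral_contDiff_smul_eq_zero hloc
    fun g hg hgc hgs => by
      have ht : IsTest (fun z => (g z : ℂ)) :=
        ⟨ofRealCLM.contDiff.comp hg, hgc.comp_left (g := ofReal) rfl,
          (tsupport_comp_subset (g := ofReal) rfl g).trans hgs⟩
      have := key _ ht
      rw [ht.setIntegral_mul] at this
      simpa only [real_smul] using this
  refine (Lp.eq_zero_iff_ae_eq_zero).2 ?_
  have h1 : ∀ᵐ z ∂volume.restrict (Metric.ball (0 : ℂ) 1), x.2 z = 0 :=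
    (ae_restrict_iff' measurableSet_ball).2 h0
  rwa [← diskMeasure_eq_restrict_ball] at h1

/-! ### The adjoint of the X-ray transform as a backprojection -/

/-- The signed distance to the origin of the line through `z` that is parallel to `e^{iθ}`. -/
def offset (θ : ℝ) (z : ℂ) : ℝ := z.re * Real.sin θ - z.im * Real.cos θ

theorem exp_I_mul_mul_sub (θ w s : ℝ) :
    exp (I * θ) * ((w : ℂ) - s * I)
      = ⟨w * Real.cos θ + s * Real.sin θ, w * Real.sin θ - s * Real.cos θ⟩ := by
  rw [mul_comm I, exp_mul_I, ← ofReal_cos, ← ofReal_sin]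
  apply Complex.ext
  · simp [-ofReal_cos, -ofReal_sin]
    ring
  · simp [-ofReal_cos, -ofReal_sin]
    ring

theorem offset_rotated (θ' θ w s : ℝ) :
    offset θ' (exp (I * θ) * ((w : ℂ) - s * I))
      = s * Real.cos (θ - θ') - w * Real.sin (θ - θ') := by
  rw [exp_I_mul_mul_sub, offset, Real.cos_sub, Real.sin_sub]
  ring

theorem offset_rotated_self (θ w s : ℝ) : offset θ (exp (I * θ) * ((w : ℂ) - s * I)) = s := by
  simp [offset_rotated]

theorem rotated_mem_disk_iff (θ w s : ℝ) :
    exp (I * θ) * ((w : ℂ) - s * I) ∈ disk ↔ w ^ 2 + s ^ 2 ≤ 1 := by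
  rw [disk, mem_closedBall_zero_iff, ← sq_le_one_iff₀ (norm_nonneg _), norm_mul, mul_comm I,
    norm_exp_ofReal_mul_I, one_mul, Complex.sq_norm, Complex.normSq_apply]
  simp [sq]

theorem continuous_offset : Continuous (fun q : ℝ × ℂ => offset q.1 q.2) := by
  unfold offset
  fun_prop

/-- The integral of `u` along a chord of the disk, the chord being described by its direction and
by its signed distance to the origin. -/
def chordIntegral (u : ℂ → ℂ) (θ s : ℝ) : ℂ :=
  ∫ w : ℝ, disk.indicator u (exp (I * θ) * ((w : ℂ) - s * I))

/-- The substitution `w = cos α - t` places the origin of the chord at its midpoint. At offset `s =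
sin α` the line meets the disk exactly for `|w| ≤ cos α`, so the limits of integration can be traded
for an indicator. -/
theorem xray_eq_chordIntegral (u : ℂ → ℂ) {p : ℝ × ℝ} (hp : p ∈ fan) :
    xray u p = chordIntegral u (p.1 + p.2) (Real.sin p.2) := by
  have hc := cos_pos_of_mem_fan hp
  have h1 : xray u p = ∫ w in (-Real.cos p.2)..(Real.cos p.2),
      u (exp (I * (p.1 + p.2 : ℝ)) * ((w : ℂ) - Real.sin p.2 * I)) := by
    simp only [xray, ray_eq, exitTime]
    rw [intervalIntegral.integral_comp_sub_left (fun w : ℝ =>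
      u (exp (I * (p.1 + p.2 : ℝ)) * ((w : ℂ) - Real.sin p.2 * I)))]
    congr 1 <;> ring
  rw [h1, intervalIntegral.integral_of_le (by linarith), ← integral_Icc_eq_integral_Ioc,
    ← integral_indicator measurableSet_Icc, chordIntegral]
  congr 1
  funext w
  have hiff : w ∈ Icc (-Real.cos p.2) (Real.cos p.2) ↔
      exp (I * (p.1 + p.2 : ℝ)) * ((w : ℂ) - Real.sin p.2 * I) ∈ disk := by
    rw [rotated_mem_disk_iff, mem_Icc, ← abs_le, ← sq_le_sq₀ (abs_nonneg w) hc.le, sq_abs]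
    constructor <;> intro h <;> linarith [Real.sin_sq_add_cos_sq p.2]
  by_cases hw : w ∈ Icc (-Real.cos p.2) (Real.cos p.2)
  · rw [indicator_of_mem hw, indicator_of_mem (hiff.1 hw)]
  · rw [indicator_of_notMem hw, indicator_of_notMem (hiff.not.1 hw)]

theorem stronglyMeasurable_chordIntegral {u : ℂ → ℂ} (hu : Continuous u) :
    StronglyMeasurable (fun q : ℝ × ℝ => chordIntegral u q.1 q.2) := by
  unfold chordIntegral
  refine StronglyMeasurable.integral_prod_right' (ν := (volume : Measure ℝ))
    (f := fun r : (ℝ × ℝ) × ℝ => disk.indicator u (exp (I * r.1.1) * ((r.2 : ℂ) - r.1.2 * I))) ?_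
  refine (hu.stronglyMeasurable.indicator measurableSet_disk).comp_measurable
    (Continuous.measurable ?_)
  fun_prop

theorem exists_norm_chordIntegral_le {u : ℂ → ℂ} (hu : Continuous u) :
    ∃ C, ∀ θ s, ‖chordIntegral u θ s‖ ≤ C := by
  obtain ⟨C, hC⟩ := (isCompact_closedBall (0 : ℂ) 1).exists_bound_of_continuousOn hu.continuousOn
  have hC0 : 0 ≤ C := (norm_nonneg _).trans (hC 0 (by simp))
  refine ⟨∫ w : ℝ, (Icc (-1 : ℝ) 1).indicator (fun _ => C) w, fun θ s => ?_⟩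
  refine norm_integral_le_of_norm_le ?_ (Filter.Eventually.of_forall fun w => ?_)
  · exact (integrable_indicator_iff measurableSet_Icc).2
      (integrableOn_const (by simp) (by simp))
  · by_cases hd : exp (I * θ) * ((w : ℂ) - s * I) ∈ disk
    · have hw : w ∈ Icc (-1 : ℝ) 1 := by
        rw [mem_Icc, ← abs_le, ← sq_le_one_iff_abs_le_one]
        nlinarith [(rotated_mem_disk_iff θ w s).1 hd]
      rw [indicator_of_mem hd, indicator_of_mem hw]
      exact hC _ hd
    · rw [indicator_of_notMem hd, norm_zero]
      exact indicator_nonneg (fun _ _ => hC0) _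

theorem chordIntegral_eq_zero (u : ℂ → ℂ) (θ : ℝ) {s : ℝ} (hs : s ∉ Icc (-1 : ℝ) 1) :
    chordIntegral u θ s = 0 := by
  rw [chordIntegral, ← integral_zero ℝ ℂ]
  congr 1
  funext w
  refine indicator_of_notMem (fun hd => hs ?_) _
  rw [mem_Icc, ← abs_le, ← sq_le_one_iff_abs_le_one]
  nlinarith [(rotated_mem_disk_iff θ w s).1 hd]

theorem integral_disk_eq_integral_chordIntegral {u : ℂ → ℂ} (hu : Continuous u) {g : ℝ → ℂ}
    (hg : Continuous g) (θ : ℝ) :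
    ∫ z, g (offset θ z) * u z ∂diskMeasure = ∫ s, g s * chordIntegral u θ s := by
  have hoff : Continuous (offset θ) := continuous_offset.comp (by fun_prop : Continuous fun z => (θ, z))
  set F : ℂ → ℂ := disk.indicator (fun z => g (offset θ z) * u z) with hF
  have hFi : Integrable F := by
    rw [hF, integrable_indicator_iff measurableSet_disk]
    exact ((hg.comp hoff).mul hu).continuousOn.integrableOn_compact (isCompact_closedBall 0 1)
  have hrot : ∀ z : ℂ, rotation (Circle.exp θ) z = exp (I * θ) * z := by
    intro z
    rw [rotation_apply, Circle.coe_exp, mul_comm I]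
  have hmp := (rotation (Circle.exp θ)).measurePreserving
  have hemb := (rotation (Circle.exp θ)).toHomeomorph.measurableEmbedding
  have h1 : ∫ z, F (exp (I * θ) * z) = ∫ z, F z := by
    have := hmp.integral_comp hemb F
    simpa only [hrot] using this
  have hi1 : Integrable (fun z => F (exp (I * θ) * z)) := by
    have := (hmp.integrable_comp_emb hemb (g := F)).2 hFi
    simpa only [Function.comp_def, hrot] using this
  have hvp := volume_preserving_equiv_real_prod.symm
  have hi2 : Integrable (fun q : ℝ × ℝ => F (exp (I * θ) * measurableEquivRealProd.symm q))
      (volume.prod volume) :=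
    (hvp.integrable_comp_emb measurableEquivRealProd.symm.measurableEmbedding).2 hi1
  -- In the frame rotated by `θ` the offset is minus the second coordinate, whence the reflection
  -- `integral_neg_eq_self` after Fubini.
  rw [diskMeasure, ← integral_indicator measurableSet_disk, ← hF, ← h1,
    ← hvp.integral_comp measurableEquivRealProd.symm.measurableEmbedding,
    Measure.volume_eq_prod, integral_prod_symm _ hi2, ← integral_neg_eq_self]
  congr 1
  funext s
  rw [chordIntegral, ← integral_const_mul]
  congr 1
  funext w
  have hz : measurableEquivRealProd.symm (w, -s) = (w : ℂ) - s * I := by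
    simp [measurableEquivRealProd, Complex.ext_iff]
  rw [hz, hF]
  by_cases hd : exp (I * θ) * ((w : ℂ) - s * I) ∈ disk
  · rw [indicator_of_mem hd, indicator_of_mem hd, offset_rotated_self]
  · rw [indicator_of_notMem hd, indicator_of_notMem hd, mul_zero]

/-- Lines with `|s| > 1` miss the disk, and `s = sin α` parametrises the others with Jacobian `cos
α`. -/
theorem integral_chordIntegral_eq (u : ℂ → ℂ) (g : ℝ → ℂ) (θ : ℝ) :
    ∫ s, g s * chordIntegral u θ s = ∫ α in Ioo (-(π / 2)) (π / 2),
      Real.cos α * (g (Real.sin α) * chordIntegral u θ (Real.sin α)) := by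
  have h0 : ∫ s, g s * chordIntegral u θ s = ∫ s in Icc (-1 : ℝ) 1, g s * chordIntegral u θ s :=
    (setIntegral_eq_integral_of_forall_compl_eq_zero fun s hs => by
      rw [chordIntegral_eq_zero u θ hs, mul_zero]).symm
  rw [h0, ← Real.bijOn_sin.image_eq,
    integral_image_eq_integral_abs_deriv_smul measurableSet_Icc
      (fun α _ => (Real.hasDerivAt_sin α).hasDerivWithinAt) Real.injOn_sin,
    integral_Icc_eq_integral_Ioo]
  refine setIntegral_congr_fun measurableSet_Ioo fun α hα => ?_
  simp only [abs_of_pos (Real.cos_pos_of_mem_Ioo hα), real_smul]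

theorem chordIntegral_periodic (u : ℂ → ℂ) (θ s : ℝ) :
    chordIntegral u (θ + 2 * π) s = chordIntegral u θ s := by
  have : exp (I * ((θ + 2 * π : ℝ) : ℂ)) = exp (I * θ) := by
    push_cast
    rw [mul_add, exp_add, mul_comm I (2 * (π : ℂ)), exp_two_pi_mul_I, mul_one]
  rw [chordIntegral, this, chordIntegral]

/-- Change of variables between chords through the disk and points of the disk with a direction. -/
theorem integral_fan_mul_xray {u : ℂ → ℂ} (hu : Continuous u) {g : ℝ → ℝ → ℂ}
    (hg : Continuous (fun q : ℝ × ℝ => g q.1 q.2))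
    (hper : ∀ θ s, g (θ + 2 * π) s = g θ s) :
    ∫ p, Real.cos p.2 * g (p.1 + p.2) (Real.sin p.2) * xray u p ∂fanMeasure
      = ∫ z, (∫ θ in (-π)..π, g θ (offset θ z)) * u z ∂diskMeasure := by
  set K : ℝ → ℝ → ℂ := fun θ α =>
    Real.cos α * (g θ (Real.sin α) * chordIntegral u θ (Real.sin α)) with hK
  have hpi := Real.pi_pos
  have hKm : StronglyMeasurable (fun q : ℝ × ℝ => K q.1 q.2) := by
    have e1 : Continuous fun q : ℝ × ℝ => (Real.cos q.2 : ℂ) := by fun_prop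
    have e2 : Continuous fun q : ℝ × ℝ => (q.1, Real.sin q.2) := by fun_prop
    have e3 := (stronglyMeasurable_chordIntegral hu).comp_measurable e2.measurable
    exact e1.stronglyMeasurable.fun_mul ((hg.comp e2).stronglyMeasurable.fun_mul e3)
  -- The interval is large enough to contain `β + α` for every point of the fan.
  have hKb : ∃ C, ∀ θ ∈ Icc (-(2 * π)) (2 * π), ∀ α, ‖K θ α‖ ≤ C := by
    obtain ⟨C₁, hC₁⟩ := exists_norm_chordIntegral_le hu
    obtain ⟨C₂, hC₂⟩ := ((isCompact_Icc (a := -(2 * π)) (b := 2 * π)).prod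
      (isCompact_Icc (a := (-1 : ℝ)) (b := 1))).exists_bound_of_continuousOn hg.continuousOn
    refine ⟨1 * (C₂ * C₁), fun θ hθ α => ?_⟩
    have h2 := hC₂ (θ, Real.sin α) ⟨hθ, Real.neg_one_le_sin α, Real.sin_le_one α⟩
    have h1 := hC₁ θ (Real.sin α)
    have h3 : ‖(Real.cos α : ℂ)‖ ≤ 1 := by
      rw [norm_real]
      exact Real.abs_cos_le_one α
    rw [hK, norm_mul, norm_mul]
    have := (norm_nonneg _).trans h2
    gcongr
  obtain ⟨C, hC⟩ := hKb
  have hvolα : IsFiniteMeasure (volume.restrict (Ioo (-(π / 2)) (π / 2))) := ⟨by simp⟩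
  have hvolθ : IsFiniteMeasure (volume.restrict (Ioc (-π) π)) := ⟨by simp⟩
  calc ∫ p, Real.cos p.2 * g (p.1 + p.2) (Real.sin p.2) * xray u p ∂fanMeasure
      = ∫ p, K (p.1 + p.2) p.2 ∂fanMeasure := by
        refine integral_congr_ae ?_
        filter_upwards [ae_restrict_mem measurableSet_fan] with p hp
        rw [xray_eq_chordIntegral u hp, hK, mul_assoc]
    _ = ∫ α in Ioo (-(π / 2)) (π / 2), ∫ β in Ioc (-π) π, K (β + α) α := by
        have hi : Integrable (fun p : ℝ × ℝ => K (p.1 + p.2) p.2) fanMeasure := by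
          refine Integrable.of_bound (hKm.comp_measurable
            (by fun_prop : Measurable fun p : ℝ × ℝ => (p.1 + p.2, p.2))).aestronglyMeasurable C ?_
          filter_upwards [ae_restrict_mem measurableSet_fan] with p hp
          refine hC _ ⟨?_, ?_⟩ _ <;>
            linarith [hp.1.1, hp.1.2, hp.2.1, hp.2.2]
        rw [fanMeasure, fan, Measure.volume_eq_prod, ← Measure.prod_restrict] at hi ⊢
        rw [integral_prod_symm _ hi]
    -- For fixed `α`, the substitution `θ = β + α` shifts the interval of integration, and
    -- periodicity moves it back.
    _ = ∫ α in Ioo (-(π / 2)) (π / 2), ∫ θ in Ioc (-π) π, K θ α := by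
        congr 1
        funext α
        have hp : Function.Periodic (fun θ => K θ α) (2 * π) := fun θ => by
          simp only [hK, hper, chordIntegral_periodic]
        rw [← intervalIntegral.integral_of_le (by linarith),
          ← intervalIntegral.integral_of_le (by linarith),
          intervalIntegral.integral_comp_add_right (fun θ => K θ α)]
        have := hp.intervalIntegral_add_eq (-π + α) (-π)
        rwa [show -π + α + 2 * π = π + α by ring, show -π + 2 * π = π by ring] at this
    _ = ∫ θ in Ioc (-π) π, ∫ α in Ioo (-(π / 2)) (π / 2), K θ α := by
        refine integral_integral_swap (f := fun α θ => K θ α) ?_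
        refine Integrable.of_bound (hKm.comp_measurable
          (by fun_prop : Measurable fun p : ℝ × ℝ => (p.2, p.1))).aestronglyMeasurable C ?_
        rw [Measure.prod_restrict]
        filter_upwards [ae_restrict_mem (measurableSet_Ioo.prod measurableSet_Ioc)] with p hp
        refine hC _ ⟨?_, ?_⟩ _ <;> linarith [hp.2.1, hp.2.2]
    _ = ∫ θ in Ioc (-π) π, ∫ z, g θ (offset θ z) * u z ∂diskMeasure := by
        congr 1
        funext θ
        have hgθ : Continuous (g θ) := hg.comp (by fun_prop : Continuous fun s : ℝ => (θ, s))
        rw [integral_disk_eq_integral_chordIntegral hu hgθ, integral_chordIntegral_eq]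
    _ = ∫ z, (∫ θ in Ioc (-π) π, g θ (offset θ z) * u z) ∂diskMeasure := by
        have hcont : Continuous (fun q : ℝ × ℂ => g q.1 (offset q.1 q.2) * u q.2) :=
          (hg.comp (continuous_fst.prodMk continuous_offset)).mul (hu.comp continuous_snd)
        refine integral_integral_swap (f := fun θ z => g θ (offset θ z) * u z) ?_
        have hK' : IsCompact (Icc (-π) π ×ˢ disk) := isCompact_Icc.prod (isCompact_closedBall 0 1)
        have := hcont.continuousOn.integrableOn_compact (μ := volume) hK'
        rw [diskMeasure, Measure.prod_restrict]
        exact IntegrableOn.mono_set this (prod_mono Ioc_subset_Icc_self le_rfl)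
    _ = _ := by
        congr 1
        funext z
        rw [intervalIntegral.integral_of_le (by linarith), integral_mul_const]

/-! ### Identification of the adjoint by testing against continuous functions. -/

theorem dense_toLp_continuous {X : Type*} [TopologicalSpace X] [MeasurableSpace X] [BorelSpace X]
    [NormalSpace X] [SecondCountableTopology X] (μ : Measure X) [μ.WeaklyRegular]
    [IsFiniteMeasure μ] :
    Dense {v : Lp ℂ 2 μ | ∃ u : X → ℂ, Continuous u ∧ v =ᵐ[μ] u} := by
  refine (BoundedContinuousFunction.toLp_denseRange ℂ μ ℂ (p := 2) (by norm_num)).mono ?_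
  rintro _ ⟨u, rfl⟩
  exact ⟨u, u.continuous, BoundedContinuousFunction.coeFn_toLp (p := 2) μ ℂ u⟩

instance : diskMeasure.WeaklyRegular := by
  unfold diskMeasure
  infer_instance

/-- The adjoint is determined by its inner products with continuous functions, which are dense and
for which Fubini is unproblematic. The factor `cos α` required in `ψ` is the Jacobian of the chord
coordinates, so no singular weight `1 / cos α` appears. -/
theorem I0star_ae_eq_backprojection {g : ℝ → ℝ → ℂ}
    (hg : Continuous (fun q : ℝ × ℝ => g q.1 q.2))
    (hper : ∀ θ s, g (θ + 2 * π) s = g θ s) {ψ : L2Fan}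
    (hψ : ψ =ᵐ[fanMeasure] fun p => Real.cos p.2 * g (p.1 + p.2) (Real.sin p.2))
    {Z : ℂ → ℂ} (hZc : Continuous Z) (hZ : ∀ z, Z z = ∫ θ in (-π)..π, g θ (offset θ z)) :
    I0star ψ =ᵐ[diskMeasure] Z := by
  have hZm : MemLp Z 2 diskMeasure :=
    memLp_of_continuousOn (isCompact_closedBall 0 1) measurableSet_disk hZc.continuousOn
  suffices h : I0star ψ = hZm.toLp Z by
    rw [h]
    exact hZm.coeFn_toLp
  refine (dense_toLp_continuous diskMeasure).eq_of_inner_left ℂ fun v hv => ?_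
  obtain ⟨u, hu, hvu⟩ := hv
  rw [I0star, ContinuousLinearMap.adjoint_inner_left, inner_toLp_left, L2.inner_def]
  have hmain := integral_fan_mul_xray hu (g := fun θ s => (starRingEnd ℂ) (g θ s))
    (continuous_conj.comp hg) (fun θ s => by rw [hper])
  calc ∫ p, inner ℂ (ψ p) (I0 v p) ∂fanMeasure
      = ∫ p, Real.cos p.2 * (starRingEnd ℂ) (g (p.1 + p.2) (Real.sin p.2)) * xray u p
          ∂fanMeasure := by
        refine integral_congr_ae ?_
        filter_upwards [hψ, coeFn_I0 v, xray_congr_ae hvu] with p h1 h2 h3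
        rw [h1, h2, h3, RCLike.inner_apply, map_mul, conj_ofReal]
        ring
    _ = _ := hmain
    _ = _ := by
        refine integral_congr_ae ?_
        filter_upwards [hvu] with z hz
        rw [hz, hZ, ← intervalIntegral.intervalIntegral_conj, mul_comm]

/-! ### Superpositions of ridge polynomials -/

/-- The monomial `z ^ a * conj z ^ b`. -/
def monomial (a b : ℕ) (z : ℂ) : ℂ := z ^ a * (starRingEnd ℂ) z ^ b

/-- The Fourier mode `e^{ilθ}`. -/
def mode (l : ℤ) (θ : ℝ) : ℂ := exp (I * (l * θ))

/-- The superposition over all directions, weighted by a Fourier mode, of the ridge functions with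
a given polynomial profile. -/
def ridgeIntegral (l : ℤ) (p : Polynomial ℂ) (z : ℂ) : ℂ :=
  ∫ θ in (-π)..π, mode l θ * p.eval (offset θ z : ℂ)

theorem continuous_mode (l : ℤ) : Continuous (mode l) := by
  unfold mode
  fun_prop

theorem mode_add (l m : ℤ) (θ : ℝ) : mode (l + m) θ = mode l θ * mode m θ := by
  rw [mode, mode, mode, ← exp_add]
  push_cast
  ring_nf

theorem mode_zero (θ : ℝ) : mode 0 θ = 1 := by
  simp [mode]

theorem mode_angle_sub (l : ℤ) (θ θ' : ℝ) : mode l (θ - θ') = mode l θ * mode (-l) θ' := by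
  rw [mode, mode, mode, ← exp_add]
  push_cast
  ring_nf

theorem mode_pow (l : ℤ) (n : ℕ) (θ : ℝ) : mode l θ ^ n = mode (n * l) θ := by
  rw [mode, mode, ← exp_nat_mul]
  push_cast
  ring_nf

theorem mode_periodic (l : ℤ) (θ : ℝ) : mode l (θ + 2 * π) = mode l θ := by
  rw [mode, mode]
  push_cast
  rw [show I * (l * ((θ : ℂ) + 2 * π)) = I * (l * θ) + l * (2 * π * I) by ring, exp_add,
    exp_int_mul_two_pi_mul_I, mul_one]

theorem integral_mode (l : ℤ) : ∫ θ in (-π)..π, mode l θ = if l = 0 then 2 * π else 0 := by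
  split_ifs with h
  · subst h
    simp only [mode_zero, intervalIntegral.integral_const, real_smul]
    push_cast
    ring
  · have hl : I * (l : ℂ) ≠ 0 := mul_ne_zero I_ne_zero (by exact_mod_cast h)
    simp only [mode, ← mul_assoc]
    rw [integral_exp_mul_complex hl]
    have := mode_periodic l (-π)
    rw [show -π + 2 * π = π by ring, mode, mode, ← mul_assoc, ← mul_assoc] at this
    rw [this, sub_self, zero_div, ofReal_zero]

/-- The offset is the imaginary part of `e^{iθ}` times the conjugate of `z`. -/
theorem offset_eq_mode (θ : ℝ) (z : ℂ) :
    (offset θ z : ℂ) = mode 1 θ * ((starRingEnd ℂ) z / (2 * I))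
      + mode (-1) θ * (-(z / (2 * I))) := by
  have h1 : mode 1 θ = Real.cos θ + Real.sin θ * I := by
    rw [mode, ofReal_cos, ofReal_sin, ← exp_mul_I]
    push_cast
    ring_nf
  have h2 : mode (-1) θ = Real.cos θ - Real.sin θ * I := by
    have := exp_mul_I (-(θ : ℂ))
    rw [Complex.cos_neg, Complex.sin_neg] at this
    rw [mode, ofReal_cos, ofReal_sin, sub_eq_add_neg, ← neg_mul, ← this]
    push_cast
    ring_nf
  have h3 : (2 * I)⁻¹ = -(I / 2) := by
    rw [mul_inv, inv_I]
    ring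
  rw [h1, h2, div_eq_mul_inv, div_eq_mul_inv, h3, offset]
  apply Complex.ext
  · simp [-ofReal_cos, -ofReal_sin]
    ring
  · simp [-ofReal_cos, -ofReal_sin]

/-- The coefficients of the expansion of a power of `offset`. -/
def offsetCoeff (m j : ℕ) : ℂ := (2 * I)⁻¹ ^ m * (-1) ^ (m - j) * m.choose j

theorem offset_pow (θ : ℝ) (z : ℂ) (m : ℕ) :
    (offset θ z : ℂ) ^ m = ∑ j ∈ Finset.range (m + 1),
      offsetCoeff m j * mode (2 * j - m) θ * monomial (m - j) j z := by
  rw [offset_eq_mode, add_pow]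
  refine Finset.sum_congr rfl fun j hj => ?_
  have hj' : j ≤ m := Nat.lt_succ_iff.1 (Finset.mem_range.1 hj)
  have e1 : mode (2 * j - m) θ = mode 1 θ ^ j * mode (-1) θ ^ (m - j) := by
    rw [mode_pow, mode_pow, ← mode_add]
    congr 1
    push_cast [hj']
    ring
  have e2 : (2 * I : ℂ)⁻¹ ^ m = (2 * I)⁻¹ ^ j * (2 * I)⁻¹ ^ (m - j) := by
    rw [← pow_add, Nat.add_sub_cancel' hj']
  rw [e1, offsetCoeff, monomial, e2, mul_pow, mul_pow, neg_pow, div_eq_mul_inv, div_eq_mul_inv,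
    mul_pow, mul_pow]
  ring

theorem mode_mul_eval_offset (l : ℤ) (p : Polynomial ℂ) (θ : ℝ) (z : ℂ) :
    mode l θ * p.eval (offset θ z : ℂ) =
      ∑ i ∈ Finset.range (p.natDegree + 1), ∑ j ∈ Finset.range (i + 1),
        mode (l + (2 * j - i)) θ * (p.coeff i * offsetCoeff i j * monomial (i - j) j z) := by
  rw [Polynomial.eval_eq_sum_range, Finset.mul_sum]
  refine Finset.sum_congr rfl fun i _ => ?_
  rw [offset_pow, Finset.mul_sum, Finset.mul_sum]
  refine Finset.sum_congr rfl fun j _ => ?_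
  rw [mode_add]
  ring

/-- The binomial expansion separates `θ` from `z` in a finite sum. Smoothness and commutation with
`𝓛` then need no differentiation under the integral sign. -/
theorem ridgeIntegral_eq_sum (l : ℤ) (p : Polynomial ℂ) (z : ℂ) :
    ridgeIntegral l p z =
      ∑ i ∈ Finset.range (p.natDegree + 1), ∑ j ∈ Finset.range (i + 1),
        (∫ θ in (-π)..π, mode (l + (2 * j - i)) θ) *
          (p.coeff i * offsetCoeff i j * monomial (i - j) j z) := by
  simp only [ridgeIntegral, mode_mul_eval_offset]
  have hc : ∀ i j : ℕ, Continuous fun θ => mode (l + (2 * j - i)) θ *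
      (p.coeff i * offsetCoeff i j * monomial (i - j) j z) := fun i j =>
    (continuous_mode _).mul continuous_const
  rw [intervalIntegral.integral_finsetSum fun i _ =>
    (continuous_finsetSum _ fun j _ => hc i j).intervalIntegrable _ _]
  refine Finset.sum_congr rfl fun i _ => ?_
  rw [intervalIntegral.integral_finsetSum fun j _ => (hc i j).intervalIntegrable _ _]
  exact Finset.sum_congr rfl fun j _ => intervalIntegral.integral_mul_const _ _

theorem contDiff_monomial (a b : ℕ) : ContDiff ℝ ∞ (monomial a b) :=
  (contDiff_id.pow a).mul (conjCLE.contDiff.pow b)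

theorem contDiff_ridgeIntegral (l : ℤ) (p : Polynomial ℂ) :
    ContDiff ℝ ∞ (ridgeIntegral l p) := by
  rw [funext (ridgeIntegral_eq_sum l p)]
  exact ContDiff.sum fun i _ => ContDiff.sum fun j _ =>
    contDiff_const.mul (contDiff_const.mul (contDiff_monomial _ _))

/-! ### The action of `𝓛` on ridge polynomials and their superpositions. -/

theorem diskOp_sum {ι : Type*} (s : Finset ι) (c : ι → ℂ) {m : ι → ℂ → ℂ}
    (hm : ∀ i, SmoothOnDisk (m i)) {z : ℂ} (hz : z ∈ disk) :
    diskOp (fun y => ∑ i ∈ s, c i * m i y) z = ∑ i ∈ s, c i * diskOp (m i) z := by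
  classical
  induction s using Finset.induction_on with
  | empty =>
    have h := diskOp_smul 0 (φ := fun _ => 0) contDiffOn_const hz
    rw [zero_smul, zero_smul] at h
    simpa only [Finset.sum_empty] using! h
  | insert i s hi ih =>
    have h1 := diskOp_smul (c i) (hm i) hz
    have h2 := diskOp_add (φ := c i • m i) (ψ := fun y => ∑ i ∈ s, c i * m i y)
      (ContDiffOn.const_smul (c i) (hm i))
      (ContDiffOn.sum fun j _ => contDiffOn_const.mul (hm j)) hz
    rw [Pi.add_apply, h1, ih, Pi.smul_apply, smul_eq_mul] at h2
    simp only [Finset.sum_insert hi]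
    exact h2

/-- The action of `𝓛` on the profile of a ridge polynomial. -/
def profileOp (p : Polynomial ℂ) : Polynomial ℂ :=
  -((1 - Polynomial.X ^ 2) * p.derivative.derivative) + 3 * Polynomial.X * p.derivative + p

theorem contDiff_eval_offset (p : Polynomial ℂ) (θ : ℝ) :
    ContDiff ℝ ∞ (fun z => p.eval (offset θ z : ℂ)) := by
  have h1 : ContDiff ℝ ∞ (fun z => (offset θ z : ℂ)) := by
    have : (fun z => (offset θ z : ℂ)) = fun z =>
        (z.re : ℂ) * (Real.sin θ : ℂ) - (z.im : ℂ) * (Real.cos θ : ℂ) := by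
      funext z
      rw [offset]
      push_cast
      ring
    rw [this]
    exact (contDiff_ofReal_re.mul contDiff_const).sub (contDiff_ofReal_im.mul contDiff_const)
  simp only [Polynomial.eval_eq_sum_range]
  exact ContDiff.sum fun i _ => contDiff_const.mul (h1.pow i)

/-- The offset `s` is a real linear form in `z` with unit gradient. Hence the Laplacian of `p(s)` is
`p''(s)`, while `D²` at `(z, z)` and `D` at `z` give `s² p''(s)` and `s p'(s)`. -/
theorem diskOp_eval_offset (p : Polynomial ℂ) (θ : ℝ) {z : ℂ} (hz : z ∈ disk) :
    diskOp (fun y => p.eval (offset θ y : ℂ)) z = (profileOp p).eval (offset θ z : ℂ) := by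
  set A : ℂ →L[ℝ] ℂ := ofRealCLM.comp (Real.sin θ • reCLM - Real.cos θ • imCLM) with hA
  have hAz : ∀ y, A y = offset θ y := fun y => by
    simp [hA, offset, mul_comm]
  have hd : ∀ (q : Polynomial ℂ) (y : ℂ), HasFDerivAt (fun y => q.eval (offset θ y : ℂ))
      (q.derivative.eval (offset θ y : ℂ) • A) y := fun q y => by
    simp only [← hAz]
    exact (q.hasDerivAt (A y)).comp_hasFDerivAt y A.hasFDerivAt
  have h1 : EqOn (fderivWithin ℝ (fun y => p.eval (offset θ y : ℂ)) disk)
      (fun y => p.derivative.eval (offset θ y : ℂ) • A) disk := fun y hy =>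
    (hd p y).hasFDerivWithinAt.fderivWithin (uniqueDiffOn_disk y hy)
  have h2 := (((hd p.derivative z).smul_const A).hasFDerivWithinAt (s := disk)).fderivWithin
    (uniqueDiffOn_disk z hz)
  rw [diskOp, fderivWithin_congr h1 (h1 hz), h1 hz, h2]
  have hA1 : A 1 = Real.sin θ := by simp [hA]
  have hAI : A I = -Real.cos θ := by simp [hA]
  have hcs : (Real.sin θ : ℂ) ^ 2 + (Real.cos θ : ℂ) ^ 2 = 1 := by
    exact_mod_cast Real.sin_sq_add_cos_sq θ
  simp only [ContinuousLinearMap.smulRight_apply, smul_apply, smul_eq_mul, hA1, hAI, hAz,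
    profileOp, Polynomial.eval_add, Polynomial.eval_neg, Polynomial.eval_mul, Polynomial.eval_sub,
    Polynomial.eval_one, Polynomial.eval_pow, Polynomial.eval_X, Polynomial.eval_ofNat]
  linear_combination (-(p.derivative.derivative.eval (offset θ z : ℂ))) * hcs

/-- The operator `𝓛` commutes with the superposition of ridge functions. -/
theorem diskOp_ridgeIntegral (l : ℤ) (p : Polynomial ℂ) {z : ℂ} (hz : z ∈ disk) :
    diskOp (ridgeIntegral l p) z = ridgeIntegral l (profileOp p) z := by
  set s : Finset (Σ _ : ℕ, ℕ) :=
    (Finset.range (p.natDegree + 1)).sigma fun i => Finset.range (i + 1)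
  set a : (Σ _ : ℕ, ℕ) → ℝ → ℂ := fun x => mode (l + (2 * x.2 - x.1))
  set m : (Σ _ : ℕ, ℕ) → ℂ → ℂ := fun x y =>
    p.coeff x.1 * offsetCoeff x.1 x.2 * monomial (x.1 - x.2) x.2 y
  have hm : ∀ x, SmoothOnDisk (m x) := fun x =>
    (contDiff_const.mul (contDiff_monomial _ _)).contDiffOn
  have h1 : ∀ θ, (fun y => mode l θ * p.eval (offset θ y : ℂ)) = fun y => ∑ x ∈ s, a x θ * m x y :=
    fun θ => funext fun y => by
      rw [mode_mul_eval_offset, Finset.sum_sigma']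
  have h2 : ridgeIntegral l p = fun y => ∑ x ∈ s, (∫ θ in (-π)..π, a x θ) * m x y :=
    funext fun y => by
      rw [ridgeIntegral_eq_sum, Finset.sum_sigma']
  -- For fixed `θ`, `𝓛` is computed in two ways on the same function: through its ridge form and
  -- through its monomial expansion.
  have h3 : ∀ θ, mode l θ * (profileOp p).eval (offset θ z : ℂ) = ∑ x ∈ s, a x θ * diskOp (m x) z :=
    fun θ => by
      rw [← diskOp_sum s _ hm hz, ← h1, ← diskOp_eval_offset p θ hz]
      exact (diskOp_smul (mode l θ) (contDiff_eval_offset p θ).contDiffOn hz).symm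
  rw [h2, diskOp_sum s _ hm hz, ridgeIntegral]
  simp only [h3]
  have hc : ∀ x, Continuous fun θ => a x θ * diskOp (m x) z := fun x =>
    (continuous_mode _).mul continuous_const
  rw [intervalIntegral.integral_finsetSum fun x _ => (hc x).intervalIntegrable _ _]
  exact Finset.sum_congr rfl fun x _ => (intervalIntegral.integral_mul_const _ _).symm

/-- This is Chebyshev's equation `(1 - x²) U'' = 3x U' - n(n+2) U`, together with `n(n+2) + 1 =
(n+1)²`. -/
theorem profileOp_chebyshev (n : ℕ) :
    profileOp (Polynomial.Chebyshev.U ℂ n) =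
      Polynomial.C (((n : ℂ) + 1) ^ 2) * Polynomial.Chebyshev.U ℂ n := by
  have h := Polynomial.Chebyshev.one_sub_X_sq_mul_derivative_derivative_U_eq_poly_in_U (R := ℂ) n
  simp only [Function.iterate_succ, Function.iterate_zero, Function.comp_apply, id] at h
  rw [profileOp, h]
  simp only [map_pow, map_add, map_natCast, map_one, Int.cast_natCast]
  ring

theorem ridgeIntegral_C_mul (l : ℤ) (c : ℂ) (p : Polynomial ℂ) (z : ℂ) :
    ridgeIntegral l (Polynomial.C c * p) z = c * ridgeIntegral l p z := by
  rw [ridgeIntegral, ridgeIntegral, ← intervalIntegral.integral_const_mul]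
  congr 1
  funext θ
  rw [Polynomial.eval_mul, Polynomial.eval_C]
  ring

/-! ### The Zernike polynomials as explicit functions -/

/-- The normalising constant of the Zernike polynomials. -/
def zernikeConst (n : ℕ) : ℂ := (-1) ^ n * I ^ n / (2 * π)

theorem zernikeConst_ne_zero (n : ℕ) : zernikeConst n ≠ 0 := by
  have : (π : ℂ) ≠ 0 := by exact_mod_cast Real.pi_ne_zero
  simp [zernikeConst, this]

/-- The Zernike polynomials, as functions on the plane. -/
def zernikeFun (n : ℕ) (k : ℤ) (z : ℂ) : ℂ :=
  zernikeConst n * ridgeIntegral (n - 2 * k) (Polynomial.Chebyshev.U ℂ n) z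

theorem contDiff_zernikeFun (n : ℕ) (k : ℤ) : ContDiff ℝ ∞ (zernikeFun n k) :=
  contDiff_const.mul (contDiff_ridgeIntegral _ _)

theorem smoothOnDisk_zernikeFun (n : ℕ) (k : ℤ) : SmoothOnDisk (zernikeFun n k) :=
  (contDiff_zernikeFun n k).contDiffOn

theorem diskOp_zernikeFun (n : ℕ) (k : ℤ) :
    EqOn (diskOp (zernikeFun n k)) ((((n : ℂ) + 1) ^ 2) • zernikeFun n k) disk := by
  intro z hz
  have h := diskOp_smul (zernikeConst n)
    (contDiff_ridgeIntegral (n - 2 * k) (Polynomial.Chebyshev.U ℂ n)).contDiffOn hz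
  have e : zernikeFun n k =
    zernikeConst n • ridgeIntegral (n - 2 * k) (Polynomial.Chebyshev.U ℂ n) := rfl
  rw [e, h, Pi.smul_apply, Pi.smul_apply, Pi.smul_apply, diskOp_ridgeIntegral _ _ hz,
    profileOp_chebyshev, ridgeIntegral_C_mul, smul_eq_mul, smul_eq_mul, smul_eq_mul]
  ring

/-- With `γ = π/2 - α`, the product `U_n(sin α) cos α` is `U_n(cos γ) sin γ = sin((n+1)γ)`.
Expanding the sine in exponentials, the quarter turn contributes the powers of `i`. -/
theorem eval_U_sin_mul_cos (n : ℕ) (α : ℝ) :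
    exp (I * ((n + 1) * α)) + (-1) ^ n * exp (-(I * ((n + 1) * α)))
      = 2 * I ^ n * ((Polynomial.Chebyshev.U ℂ n).eval (Real.sin α : ℂ) * Real.cos α) := by
  have h := Polynomial.Chebyshev.U_complex_cos (π / 2 - α : ℂ) n
  rw [Complex.cos_pi_div_two_sub, Complex.sin_pi_div_two_sub] at h
  rw [ofReal_sin, ofReal_cos, h, Complex.sin]
  have h1 : exp (((((n : ℤ) : ℂ) + 1) * (π / 2 - α)) * I)
      = I ^ (n + 1) * exp (-(I * ((n + 1) * α))) := by
    have hI : I ^ (n + 1) = exp ((n + 1 : ℕ) * (π / 2 * I)) := by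
      rw [exp_nat_mul, exp_pi_div_two_mul_I]
    rw [hI, ← exp_add]
    push_cast
    ring_nf
  have h2 : exp (-((((n : ℤ) : ℂ) + 1) * (π / 2 - α)) * I)
      = (-I) ^ (n + 1) * exp (I * ((n + 1) * α)) := by
    have hI : (-I) ^ (n + 1) = exp ((n + 1 : ℕ) * (-π / 2 * I)) := by
      rw [exp_nat_mul, exp_neg_pi_div_two_mul_I]
    rw [hI, ← exp_add]
    push_cast
    ring_nf
  rw [h1, h2]
  have h3 : I ^ n * (-I) ^ n = 1 := by
    rw [← mul_pow]
    simp
  have h4 : I ^ n * I ^ n = (-1) ^ n := by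
    rw [← mul_pow]
    simp
  rw [pow_succ, pow_succ]
  generalize exp (I * ((n + 1) * α)) = E
  generalize exp (-(I * ((n + 1) * α))) = E'
  linear_combination I ^ 2 * E * h3 + I ^ 2 * E' * h4 + (E + (-1) ^ n * E') * I_sq

/-- This exhibits the shape `cos α · g(β + α, sin α)` that `I0star_ae_eq_backprojection` asks for.
The factor `2 iⁿ` from `eval_U_sin_mul_cos` accounts for `zernikeConst`. -/
theorem psi_eq (n : ℕ) (k : ℤ) (p : ℝ × ℝ) :
    psi n k p = Real.cos p.2 * (zernikeConst n * (mode (n - 2 * k) (p.1 + p.2) *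
      (Polynomial.Chebyshev.U ℂ n).eval (Real.sin p.2 : ℂ))) := by
  rw [psi, eval_U_sin_mul_cos, zernikeConst, mode]
  have : (π : ℂ) ≠ 0 := by exact_mod_cast Real.pi_ne_zero
  push_cast
  field_simp
  ring

theorem zernike_ae_eq (n : ℕ) (k : ℤ) : zernike n k =ᵐ[diskMeasure] zernikeFun n k := by
  refine I0star_ae_eq_backprojection (g := fun θ s => zernikeConst n *
    (mode (n - 2 * k) θ * (Polynomial.Chebyshev.U ℂ n).eval (s : ℂ))) ?_ ?_ ?_
    (contDiff_zernikeFun n k).continuous ?_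
  · have h1 := continuous_mode (n - 2 * k)
    fun_prop
  · intro θ s
    rw [mode_periodic]
  · refine (memLp_psi n k).coeFn_toLp.trans (Filter.Eventually.of_forall fun p => ?_)
    exact psi_eq n k p
  · intro z
    rw [intervalIntegral.integral_const_mul]
    rfl

/-! ### The X-ray transform of the Zernike polynomials -/

/-- With `x = e^{iδ}` and `y = e^{-iδ}`, the sums `∑ x^i y^{n-i}` satisfy the Chebyshev recurrence,
since `x + y = 2 cos δ` and `x y = 1`. The recurrence avoids dividing by `sin δ`, which may vanish.
-/
theorem eval_U_cos_eq_sum (n : ℕ) (δ : ℝ) :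
    (Polynomial.Chebyshev.U ℂ n).eval (Real.cos δ : ℂ)
      = ∑ i ∈ Finset.range (n + 1), mode (2 * i - n) δ := by
  set x := mode 1 δ with hx
  set y := mode (-1) δ with hy
  have hxy : x * y = 1 := by
    rw [hx, hy, ← mode_add, add_neg_cancel, mode_zero]
  have hc : 2 * (Real.cos δ : ℂ) = x + y := by
    rw [ofReal_cos, Complex.cos, hx, hy, mode, mode]
    push_cast
    ring_nf
  set S : ℕ → ℂ := fun n => ∑ i ∈ Finset.range (n + 1), x ^ i * y ^ (n - i) with hS
  have hS1 : ∀ n, S (n + 1) = y * S n + x ^ (n + 1) := by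
    intro n
    simp only [hS]
    rw [Finset.sum_range_succ _ (n + 1), Nat.sub_self, pow_zero, mul_one, Finset.mul_sum]
    congr 1
    refine Finset.sum_congr rfl fun i hi => ?_
    rw [Nat.sub_add_comm (Nat.lt_succ_iff.1 (Finset.mem_range.1 hi)), pow_succ]
    ring
  generalize (Real.cos δ : ℂ) = c at hc ⊢
  have hU : ∀ n : ℕ, (Polynomial.Chebyshev.U ℂ n).eval c = S n := by
    intro n
    induction n using Nat.twoStepInduction with
    | zero => simp [hS]
    | one =>
      have h := hS1 0
      simp only [zero_add] at h
      rw [h]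
      simp only [Nat.cast_one, Polynomial.Chebyshev.U_one, Polynomial.eval_mul,
        Polynomial.eval_ofNat, Polynomial.eval_X, hc]
      simp [hS, add_comm]
    | more n ih1 ih2 =>
      push_cast at ih2 ⊢
      rw [Polynomial.Chebyshev.U_add_two]
      simp only [Polynomial.eval_sub, Polynomial.eval_mul, Polynomial.eval_ofNat,
        Polynomial.eval_X, ih1, ih2, hc]
      rw [hS1 (n + 1), hS1 n]
      linear_combination (S n) * hxy
  rw [hU]
  refine Finset.sum_congr rfl fun i hi => ?_
  have hi' : i ≤ n := Nat.lt_succ_iff.1 (Finset.mem_range.1 hi)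
  rw [hx, hy, mode_pow, mode_pow, ← mode_add]
  congr 1
  push_cast [hi']
  ring

/-- The kernel `U_n(cos δ)` contains the frequencies `-n, -n+2, …, n`, each with coefficient one, so
convolution with it reproduces these modes up to `2π`. The condition `k ≤ n` places `n - 2k` among
them, at the index `i = n - k`. -/
theorem integral_mode_mul_eval_U_cos {n k : ℕ} (hk : k ≤ n) (θ' : ℝ) :
    ∫ θ in (-π)..π, mode (n - 2 * k) θ * (Polynomial.Chebyshev.U ℂ n).eval
      (Real.cos (θ' - θ) : ℂ) = 2 * π * mode (n - 2 * k) θ' := by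
  have h1 : ∀ θ, mode (n - 2 * k) θ * (Polynomial.Chebyshev.U ℂ n).eval (Real.cos (θ' - θ) : ℂ)
      = ∑ i ∈ Finset.range (n + 1), mode (2 * i - n) θ' * mode (2 * (n - k - i)) θ := by
    intro θ
    rw [eval_U_cos_eq_sum, Finset.mul_sum]
    refine Finset.sum_congr rfl fun i _ => ?_
    rw [mode_angle_sub, mul_left_comm, ← mode_add]
    congr 2
    ring
  simp only [h1]
  have hc : ∀ i : ℕ, Continuous fun θ => mode (2 * i - n) θ' * mode (2 * (n - k - i)) θ :=
    fun i => continuous_const.mul (continuous_mode _)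
  rw [intervalIntegral.integral_finsetSum fun i _ => (hc i).intervalIntegrable _ _,
    Finset.sum_eq_single (n - k)]
  · rw [intervalIntegral.integral_const_mul, integral_mode, if_pos (by push_cast [hk]; ring)]
    push_cast [hk]
    rw [mul_comm]
    congr 2
    ring
  · intro i _ hi
    rw [intervalIntegral.integral_const_mul, integral_mode, if_neg (by omega)]
    simp
  · intro h
    exact absurd (Finset.mem_range.2 (by omega)) h

/-- The integral of a Chebyshev ridge function along a chord. -/
theorem integral_eval_U_chord (n : ℕ) (α δ : ℝ) :
    ∫ t in (0 : ℝ)..2 * Real.cos α, (Polynomial.Chebyshev.U ℂ n).eval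
      ((Real.sin α * Real.cos δ - (Real.cos α - t) * Real.sin δ : ℝ) : ℂ)
      = 2 / (n + 1) * (Real.cos α * (Polynomial.Chebyshev.U ℂ n).eval (Real.sin α : ℂ))
        * (Polynomial.Chebyshev.U ℂ n).eval (Real.cos δ : ℂ) := by
  have hn : (n : ℂ) + 1 ≠ 0 := by exact_mod_cast n.succ_ne_zero
  -- When `sin δ = 0` the ridge function is constant along the chord, and `U_n(±1) = (±1)ⁿ (n+1)`
  -- cancels the denominator.
  by_cases hδ : Real.sin δ = 0
  · simp only [hδ, mul_zero, sub_zero]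
    rw [intervalIntegral.integral_const, sub_zero, real_smul]
    have hc : Real.cos δ = 1 ∨ Real.cos δ = -1 := by
      have := Real.sin_sq_add_cos_sq δ
      rw [hδ] at this
      exact mul_self_eq_one_iff.1 (by linarith)
    rcases hc with hc | hc
    · rw [hc]
      simp only [mul_one, ofReal_one, Polynomial.Chebyshev.U_eval_one]
      push_cast
      field_simp
    · rw [hc]
      simp only [mul_neg, mul_one, ofReal_neg, ofReal_one, Polynomial.Chebyshev.U_eval_neg,
        Polynomial.Chebyshev.U_eval_one]
      push_cast
      field_simp
  · have hδ' : (Real.sin δ : ℂ) ≠ 0 := by exact_mod_cast hδ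
    -- A primitive, since the derivative of `T_{n+1}` is `(n+1) U_n` and the argument has slope `sin
    -- δ` in `t`.
    set F : ℝ → ℂ := fun t => (Polynomial.Chebyshev.T ℂ (n + 1)).eval
      ((Real.sin α * Real.cos δ - (Real.cos α - t) * Real.sin δ : ℝ) : ℂ)
        / ((n + 1) * Real.sin δ) with hF
    have hd : ∀ t : ℝ, HasDerivAt F ((Polynomial.Chebyshev.U ℂ n).eval
        ((Real.sin α * Real.cos δ - (Real.cos α - t) * Real.sin δ : ℝ) : ℂ)) t := by
      intro t
      have h1 : HasDerivAt (fun t : ℝ => Real.sin α * Real.cos δ - (Real.cos α - t) * Real.sin δ)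
          (Real.sin δ) t := by
        have := (((hasDerivAt_id t).const_sub (Real.cos α)).mul_const (Real.sin δ)).const_sub
          (Real.sin α * Real.cos δ)
        simpa using this
      have h2 := ((Polynomial.Chebyshev.T ℂ (n + 1)).hasDerivAt
        ((Real.sin α * Real.cos δ - (Real.cos α - t) * Real.sin δ : ℝ) : ℂ)).comp t
          h1.ofReal_comp
      have h3 := h2.div_const ((n + 1) * (Real.sin δ : ℂ))
      rw [Polynomial.Chebyshev.T_derivative_eq_U, add_sub_cancel_right] at h3
      refine h3.congr_deriv ?_
      simp only [Polynomial.eval_mul, Int.cast_add, Int.cast_natCast, Int.cast_one,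
        Polynomial.eval_add, Polynomial.eval_natCast, Polynomial.eval_one]
      field_simp
    have hcont : Continuous fun t : ℝ => (Polynomial.Chebyshev.U ℂ n).eval
        ((Real.sin α * Real.cos δ - (Real.cos α - t) * Real.sin δ : ℝ) : ℂ) := by fun_prop
    rw [intervalIntegral.integral_eq_sub_of_hasDerivAt (fun t _ => hd t)
      (hcont.intervalIntegrable _ _)]
    -- With `γ = π/2 - α`, the arguments at the two ends of the chord are `cos(γ - δ)` and `cos(γ +
    -- δ)`. The difference of the values of `T_{n+1}` is then `2 sin((n+1)γ) sin((n+1)δ)`, a product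
    -- of values of `U_n` and sines.
    have e1 : ((Real.sin α * Real.cos δ - (Real.cos α - 2 * Real.cos α) * Real.sin δ : ℝ) : ℂ)
        = Complex.cos ((π / 2 - α : ℂ) - δ) := by
      rw [Complex.cos_sub, Complex.cos_pi_div_two_sub, Complex.sin_pi_div_two_sub]
      push_cast
      ring
    have e2 : ((Real.sin α * Real.cos δ - (Real.cos α - 0) * Real.sin δ : ℝ) : ℂ)
        = Complex.cos ((π / 2 - α : ℂ) + δ) := by
      rw [Complex.cos_add, Complex.cos_pi_div_two_sub, Complex.sin_pi_div_two_sub]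
      push_cast
      ring
    have h1 := Polynomial.Chebyshev.U_complex_cos (π / 2 - α : ℂ) n
    rw [Complex.cos_pi_div_two_sub, Complex.sin_pi_div_two_sub] at h1
    have h2 := Polynomial.Chebyshev.U_complex_cos (δ : ℂ) n
    simp only [hF]
    rw [e1, e2, Polynomial.Chebyshev.T_complex_cos, Polynomial.Chebyshev.T_complex_cos, mul_sub,
      mul_add, Complex.cos_sub, Complex.cos_add]
    push_cast at h1 h2 hδ' ⊢
    rw [← h1, ← h2]
    field_simp
    ring

/-- After exchanging the integrals, each ridge contributes the factor `cos α U_n(sin α)`,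
independent of `θ`. What remains is the reproducing integral at `θ' = β + α`, which rebuilds the
Fourier factor of `ψ_{n,k}`. -/
theorem xray_zernikeFun {n k : ℕ} (hk : k ≤ n) (p : ℝ × ℝ) :
    xray (zernikeFun n k) p = 4 * π / (n + 1) * psi n k p := by
  have hπ : (π : ℂ) ≠ 0 := by exact_mod_cast Real.pi_ne_zero
  have hoff : ∀ t θ, offset θ (ray p t) = Real.sin p.2 * Real.cos (p.1 + p.2 - θ)
      - (Real.cos p.2 - t) * Real.sin (p.1 + p.2 - θ) := fun t θ => by
    rw [ray_eq, offset_rotated]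
  set U := Polynomial.Chebyshev.U ℂ n with hU
  have hcont : Continuous (Function.uncurry fun t θ : ℝ =>
      mode (n - 2 * k) θ * U.eval (offset θ (ray p t) : ℂ)) := by
    have h1 := continuous_mode (n - 2 * k)
    simp only [hoff, Function.uncurry_def]
    fun_prop
  calc xray (zernikeFun n k) p
      = zernikeConst n * ∫ t in (0 : ℝ)..2 * Real.cos p.2, ∫ θ in (-π)..π,
          mode (n - 2 * k) θ * U.eval (offset θ (ray p t) : ℂ) := by
        rw [xray, exitTime, ← intervalIntegral.integral_const_mul]
        rfl
    _ = zernikeConst n * ∫ θ in (-π)..π, ∫ t in (0 : ℝ)..2 * Real.cos p.2,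
          mode (n - 2 * k) θ * U.eval (offset θ (ray p t) : ℂ) := by
        rw [intervalIntegral_intervalIntegral_swap]
        exact (hcont.continuousOn.integrableOn_compact (isCompact_uIcc.prod isCompact_uIcc)).mono_set
          (prod_mono uIoc_subset_uIcc uIoc_subset_uIcc)
    _ = zernikeConst n * ∫ θ in (-π)..π, 2 / (n + 1) *
          (Real.cos p.2 * U.eval (Real.sin p.2 : ℂ)) * (mode (n - 2 * k) θ *
            U.eval (Real.cos (p.1 + p.2 - θ) : ℂ)) := by
        congr 2
        funext θ
        rw [intervalIntegral.integral_const_mul]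
        simp only [hoff]
        rw [integral_eval_U_chord]
        ring
    _ = _ := by
        rw [intervalIntegral.integral_const_mul, integral_mode_mul_eval_U_cos hk, psi_eq]
        push_cast
        field_simp
        ring

theorem I0_zernike {n k : ℕ} (hk : k ≤ n) :
    I0 (zernike n k) = ((4 * (π : ℂ)) / ((n : ℂ) + 1)) • psiL2 n k := by
  refine Lp.ext ?_
  filter_upwards [coeFn_I0 (zernike n k), xray_congr_ae (zernike_ae_eq n k),
    Lp.coeFn_smul ((4 * (π : ℂ)) / ((n : ℂ) + 1)) (psiL2 n k),
    (memLp_psi n k).coeFn_toLp] with p h1 h2 h3 h4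
  rw [h1, h2, h3, xray_zernikeFun hk, Pi.smul_apply, smul_eq_mul, psiL2, h4]

theorem I0star_I0_zernike {n k : ℕ} (hk : k ≤ n) :
    I0star (I0 (zernike n k)) = ((4 * (π : ℂ)) / ((n : ℂ) + 1)) • zernike n k := by
  rw [I0_zernike hk, map_smul, zernike]

theorem zernike_mem_smoothL2 (n : ℕ) (k : ℤ) : zernike n k ∈ smoothL2 :=
  ⟨zernikeFun n k, smoothOnDisk_zernikeFun n k, zernike_ae_eq n k⟩

theorem smoothOp_zernike (n : ℕ) (k : ℤ) :
    smoothOp ⟨zernike n k, zernike_mem_smoothL2 n k⟩ = (((n : ℂ) + 1) ^ 2) • zernike n k := by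
  refine Lp.ext ?_
  refine (smoothOp_apply_ae_eq _ (smoothOnDisk_zernikeFun n k) (zernike_ae_eq n k)).trans ?_
  refine (ae_eq_of_eqOn_disk (diskOp_zernikeFun n k)).trans ?_
  exact (((zernike_ae_eq n k).const_smul _).symm).trans (Lp.coeFn_smul _ _).symm

/-! ### Completeness of the Zernike polynomials -/

/-- The space of functions spanned by the Zernike polynomials. -/
def zernikeFunSpan : Submodule ℂ (ℂ → ℂ) :=
  Submodule.span ℂ {f | ∃ n k : ℕ, k ≤ n ∧ f = zernikeFun n k}

theorem ridgeIntegral_mem_zernikeFunSpan {n k : ℕ} (hk : k ≤ n) :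
    ridgeIntegral (n - 2 * k) (Polynomial.Chebyshev.U ℂ n) ∈ zernikeFunSpan :=
  (Submodule.smul_mem_iff _ (zernikeConst_ne_zero n)).1 (Submodule.subset_span ⟨n, k, hk, rfl⟩)

theorem offsetCoeff_ne_zero {m j : ℕ} (hj : j ≤ m) : offsetCoeff m j ≠ 0 := by
  have : (m.choose j : ℂ) ≠ 0 := by exact_mod_cast (Nat.choose_pos hj).ne'
  simp [offsetCoeff, this]

/-- The argument is triangular. In the part of degree `n` of the ridge integral, the frequency is
`2(j - k)`, so only the monomial with `j = k` survives; its coefficient is nonzero because `U_n` has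
leading coefficient `2ⁿ`. The parts of lower degree are in the span by induction. -/
theorem monomial_mem_zernikeFunSpan (n : ℕ) :
    ∀ k ≤ n, monomial (n - k) k ∈ zernikeFunSpan := by
  induction n using Nat.strong_induction_on with
  | _ n ih =>
    intro k hk
    have hmem := ridgeIntegral_mem_zernikeFunSpan hk
    set p := Polynomial.Chebyshev.U ℂ n with hp
    have hdeg : p.natDegree = n := Polynomial.Chebyshev.natDegree_U_natCast ℂ n
    have hlead : p.coeff n = 2 ^ n := by
      have := Polynomial.Chebyshev.leadingCoeff_U_natCast ℂ n
      rwa [Polynomial.leadingCoeff, ← hp, hdeg] at this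
    set c : ℕ → ℕ → ℂ := fun i j =>
      (∫ θ in (-π)..π, mode (n - 2 * k + (2 * j - i)) θ) * (p.coeff i * offsetCoeff i j) with hc
    have hexp : ridgeIntegral (n - 2 * k) p =
        ∑ i ∈ Finset.range n, ∑ j ∈ Finset.range (i + 1), c i j • monomial (i - j) j
          + c n k • monomial (n - k) k := by
      funext z
      rw [ridgeIntegral_eq_sum, hdeg, Finset.sum_range_succ,
        Finset.sum_eq_single (s := Finset.range (n + 1)) k]
      · simp only [Pi.add_apply, Finset.sum_apply, Pi.smul_apply, smul_eq_mul, hc, mul_assoc]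
      · intro j _ hj
        rw [integral_mode, if_neg (by omega), ofReal_zero, zero_mul]
      · intro h
        exact absurd (Finset.mem_range.2 (by omega)) h
    have hlow : ∑ i ∈ Finset.range n, ∑ j ∈ Finset.range (i + 1), c i j • monomial (i - j) j
        ∈ zernikeFunSpan :=
      Submodule.sum_mem _ fun i hi => Submodule.sum_mem _ fun j hj => Submodule.smul_mem _ _
        (ih i (Finset.mem_range.1 hi) j (Nat.lt_succ_iff.1 (Finset.mem_range.1 hj)))
    have hcnk : c n k ≠ 0 := by
      have hπ : (π : ℂ) ≠ 0 := by exact_mod_cast Real.pi_ne_zero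
      simp only [hc]
      rw [integral_mode, if_pos (by ring), hlead]
      exact mul_ne_zero (by simp [hπ]) (mul_ne_zero (by simp) (offsetCoeff_ne_zero hk))
    rw [hexp] at hmem
    exact (Submodule.smul_mem_iff _ hcnk).1 ((Submodule.add_mem_iff_right _ hlow).1 hmem)

theorem adjoin_le_zernikeFunSpan :
    Subalgebra.toSubmodule (Algebra.adjoin ℂ {(fun z => z : ℂ → ℂ), fun z => (starRingEnd ℂ) z})
      ≤ zernikeFunSpan := by
  rw [Algebra.adjoin_eq_span, Submodule.span_le]
  intro f hf
  obtain ⟨a, b, rfl⟩ := (Submonoid.mem_closure_pair _ _ _).1 hf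
  have := monomial_mem_zernikeFunSpan (a + b) b (Nat.le_add_left b a)
  rwa [Nat.add_sub_cancel] at this

/-! ### Stone–Weierstrass approximation, and density in `L²`. -/

instance : CompactSpace disk := isCompact_iff_compactSpace.1 (isCompact_closedBall 0 1)

theorem exists_adjoin_eq_of_mem_starClosure {b : C(disk, ℂ)}
    (hb : b ∈ (polynomialFunctions disk).starClosure) :
    ∃ P ∈ Algebra.adjoin ℂ {(fun z => z : ℂ → ℂ), fun z => (starRingEnd ℂ) z},
      ∀ z : disk, b z = P z := by
  rw [polynomialFunctions.starClosure_eq_adjoin_X] at hb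
  induction hb using Algebra.adjoin_induction with
  | mem f hf =>
    rcases hf with hf | hf
    · rw [mem_singleton_iff] at hf
      subst hf
      exact ⟨_, Algebra.subset_adjoin (mem_insert _ _), fun z => by simp⟩
    · rw [mem_star, mem_singleton_iff, star_eq_iff_star_eq] at hf
      subst hf
      exact ⟨_, Algebra.subset_adjoin (mem_insert_of_mem _ rfl), fun z => by simp⟩
  | algebraMap r => exact ⟨_, Subalgebra.algebraMap_mem _ r, fun z => rfl⟩
  | add f g _ _ hf hg =>
    obtain ⟨P, hP, hfP⟩ := hf
    obtain ⟨Q, hQ, hgQ⟩ := hg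
    exact ⟨P + Q, Subalgebra.add_mem _ hP hQ, fun z => by simp [hfP, hgQ]⟩
  | mul f g _ _ hf hg =>
    obtain ⟨P, hP, hfP⟩ := hf
    obtain ⟨Q, hQ, hgQ⟩ := hg
    exact ⟨P * Q, Subalgebra.mul_mem _ hP hQ, fun z => by simp [hfP, hgQ]⟩

/-- By Stone–Weierstrass, polynomials in `z` and its conjugate are uniformly dense on the disk, and
all of them lie in the Zernike span. -/
theorem exists_zernikeFunSpan_near {u : ℂ → ℂ} (hu : Continuous u) {ε : ℝ} (hε : 0 < ε) :
    ∃ P ∈ zernikeFunSpan, ∀ z ∈ disk, ‖u z - P z‖ ≤ ε := by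
  set v : C(disk, ℂ) := ⟨fun z => u z, hu.comp continuous_subtype_val⟩
  have hv : v ∈ (polynomialFunctions disk).starClosure.topologicalClosure := by
    rw [polynomialFunctions.starClosure_topologicalClosure]
    trivial
  obtain ⟨b, hb, hvb⟩ := Metric.mem_closure_iff.1 hv ε hε
  obtain ⟨P, hP, hbP⟩ := exists_adjoin_eq_of_mem_starClosure hb
  refine ⟨P, adjoin_le_zernikeFunSpan hP, fun z hz => ?_⟩
  rw [← hbP ⟨z, hz⟩, ← dist_eq_norm]
  exact (ContinuousMap.dist_apply_le_dist (f := v) (g := b) ⟨z, hz⟩).trans hvb.le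

/-- The subspace of `L²` of the disk spanned by the Zernike polynomials. -/
def zernikeSpan : Submodule ℂ L2Disk :=
  Submodule.span ℂ {v | ∃ n k : ℕ, k ≤ n ∧ v = zernike n k}

theorem exists_zernikeSpan_ae_eq {P : ℂ → ℂ} (hP : P ∈ zernikeFunSpan) :
    ∃ v ∈ zernikeSpan, v =ᵐ[diskMeasure] P := by
  induction hP using Submodule.span_induction with
  | mem f hf =>
    obtain ⟨n, k, hk, rfl⟩ := hf
    exact ⟨zernike n k, Submodule.subset_span ⟨n, k, hk, rfl⟩, zernike_ae_eq n k⟩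
  | zero => exact ⟨0, Submodule.zero_mem _, Lp.coeFn_zero _ _ _⟩
  | add f g _ _ hf hg =>
    obtain ⟨v, hv, hvf⟩ := hf
    obtain ⟨w, hw, hwg⟩ := hg
    exact ⟨v + w, Submodule.add_mem _ hv hw, (Lp.coeFn_add v w).trans (hvf.add hwg)⟩
  | smul c f _ hf =>
    obtain ⟨v, hv, hvf⟩ := hf
    exact ⟨c • v, Submodule.smul_mem _ c hv, (Lp.coeFn_smul c v).trans (hvf.const_smul c)⟩

theorem dense_zernikeSpan : Dense (zernikeSpan : Set L2Disk) := by
  rw [← dense_closure]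
  refine (dense_toLp_continuous diskMeasure).mono ?_
  rintro w ⟨u, hu, hwu⟩
  refine Metric.mem_closure_iff.2 fun ε hε => ?_
  -- `M` is the constant that bounds the `L²` norm by the uniform norm on the disk. The tolerance
  -- below divides by `2 (M + 1)`, which is positive and makes the final bound strict.
  set M : ℝ := measureUnivNNReal diskMeasure ^ (2 : ℝ≥0∞).toReal⁻¹
  have hM0 : 0 ≤ M := by positivity
  obtain ⟨P, hP, hPu⟩ := exists_zernikeFunSpan_near hu (ε := ε / (2 * (M + 1))) (by positivity)
  obtain ⟨v, hv, hvP⟩ := exists_zernikeSpan_ae_eq hP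
  refine ⟨v, hv, ?_⟩
  have hle : ‖w - v‖ ≤ M * (ε / (2 * (M + 1))) := by
    refine Lp.norm_le_of_ae_bound (μ := diskMeasure) (f := w - v) (by positivity) ?_
    filter_upwards [Lp.coeFn_sub w v, hwu, hvP, ae_restrict_mem measurableSet_disk]
      with z h1 h2 h3 hz
    rw [h1, Pi.sub_apply, h2, h3]
    exact hPu z hz
  rw [dist_eq_norm]
  refine hle.trans_lt ?_
  rw [mul_div_assoc', div_lt_iff₀ (by positivity)]
  nlinarith

/-! ### The square of the normal operator inverts `𝓛` -/

/-- The map `f ↦ (N² f, (4π)² f)` is continuous and sends every Zernike polynomial into the graph of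
`smoothOp`. By density it sends all of `L²` into the closure of that graph, which is the graph of
`closedOp`. -/
theorem normal_sq_mem_graph (f : L2Disk) :
    (I0star (I0 (I0star (I0 f))), ((4 * (π : ℂ)) ^ 2) • f) ∈ closedOp.graph := by
  set N : L2Disk →L[ℂ] L2Disk := I0star.comp I0 with hN
  set T : L2Disk →L[ℂ] L2Disk × L2Disk :=
    (N.comp N).prod (((4 * (π : ℂ)) ^ 2) • ContinuousLinearMap.id ℂ L2Disk) with hT
  have hspan : zernikeSpan ≤ smoothOp.graph.comap T.toLinearMap := by
    refine Submodule.span_le.2 ?_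
    rintro _ ⟨n, k, hk, rfl⟩
    have hn : (n : ℂ) + 1 ≠ 0 := by exact_mod_cast n.succ_ne_zero
    have h1 : N (zernike n k) = ((4 * (π : ℂ)) / ((n : ℂ) + 1)) • zernike n k :=
      I0star_I0_zernike hk
    have h2 : (zernike n k, (((n : ℂ) + 1) ^ 2) • zernike n k) ∈ smoothOp.graph :=
      (LinearPMap.mem_graph_iff _).2
        ⟨⟨zernike n k, zernike_mem_smoothL2 n k⟩, rfl, smoothOp_zernike n k⟩
    have h3 : T (zernike n k) = (((4 * (π : ℂ)) / ((n : ℂ) + 1)) ^ 2) •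
        (zernike n k, (((n : ℂ) + 1) ^ 2) • zernike n k) := by
      have e : ((4 * (π : ℂ)) / ((n : ℂ) + 1)) ^ 2 * ((n : ℂ) + 1) ^ 2 = (4 * (π : ℂ)) ^ 2 := by
        field_simp
      rw [Prod.smul_mk, smul_smul, e, sq ((4 * (π : ℂ)) / ((n : ℂ) + 1)), ← smul_smul, ← h1,
        ← map_smul, ← h1]
      rfl
    change T (zernike n k) ∈ smoothOp.graph
    rw [h3]
    exact Submodule.smul_mem _ _ h2
  have hcl : IsClosed {v | T v ∈ smoothOp.graph.topologicalClosure} :=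
    (Submodule.isClosed_topologicalClosure _).preimage T.continuous
  have hsub : (zernikeSpan : Set L2Disk) ⊆ {v | T v ∈ smoothOp.graph.topologicalClosure} :=
    fun v hv => smoothOp.graph.le_topologicalClosure (hspan hv)
  have hall : T f ∈ smoothOp.graph.topologicalClosure :=
    closure_minimal hsub hcl (dense_zernikeSpan f)
  rw [smoothOp_isClosable.graph_closure_eq_closure_graph] at hall
  exact hall

end DiskXray

end

theorem theorem3p3 :
    (∀ f : DiskXray.L2Disk,
      ∃ hf : DiskXray.I0star (DiskXray.I0 (DiskXray.I0star (DiskXray.I0 f))) ∈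
          DiskXray.closedOp.domain,
        DiskXray.closedOp ⟨DiskXray.I0star (DiskXray.I0 (DiskXray.I0star (DiskXray.I0 f))), hf⟩ =
          ((4 * (π : ℂ)) ^ 2) • f) ∧
    (∀ n k : ℕ, k ≤ n →
      DiskXray.I0star (DiskXray.I0 (DiskXray.zernike n k)) =
          ((4 * (π : ℂ)) / ((n : ℂ) + 1)) • DiskXray.zernike n k ∧
      ∃ hZ : DiskXray.zernike n k ∈ DiskXray.smoothOp.domain,
        DiskXray.smoothOp ⟨DiskXray.zernike n k, hZ⟩ =
          (((n : ℂ) + 1) ^ 2) • DiskXray.zernike n k) := by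
  -- For the Zernike polynomials, membership in the domain of `smoothOp`, and not merely of its
  -- closure, expresses smoothness up to the boundary.
  refine ⟨fun f => ?_, fun n k hk => ⟨DiskXray.I0star_I0_zernike hk,
    DiskXray.zernike_mem_smoothL2 n k, DiskXray.smoothOp_zernike n k⟩⟩
  obtain ⟨⟨v, hv⟩, h1, h2⟩ := (LinearPMap.mem_graph_iff _).1 (DiskXray.normal_sq_mem_graph f)
  simp only at h1 h2
  subst h1
  exact ⟨hv, h2⟩
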